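/- **Setting.** An instance of NAE-$K$-SAT on variables $x_1,\dots,x_n$ is a list of clauses, each consisting of $K$ literals on distinct variables; an assignment $\sigma\in\{0,1\}^n$ satisfies it if every clause contains a literal of value $1$ and a literal of value $0$. Let $\Phi(n,dn)$ be the random instance with $\lfloor dn\rfloor$ independent clauses, each on a uniformly random set of $K$ distinct variables, each of which is negated independently with probability $1/2$. A *reduced instance* may also contain clauses of sign $+$ (satisfied iff some literal has value $0$) and of sign $-$ (satisfied iff some literal has value $1$). Setting a variable $x$ to $b$ deletes $x$, removes all clauses that become satisfied or violated, and gives an unsigned clause containing $x$ the sign $+$ or $-$ according to whether its literal on $x$ has value $1$ or $0$. The *complement* $\bar\Phi$ of $\Phi$ has the same literals and all signs flipped. For even $r$, $B_\Phi(x,r)$ is the depth-$r$ neighborhood of $x$ in the factor graph (bipartite graph of variables and clauses, with literal polarities and clause signs), viewed as a reduced instance rooted at $x$. A *decision rule* $\tau$ assigns to each reduced instance $\Phi$ and variable $x$ a number $\tau(\Phi,x)\in[0,1]$. It is *$r$-local* if $\tau(\Phi,x)$ depends only on the isomorphism class of the rooted instance $B_\Phi(x,r)$, and *balanced* if $\tau(\bar\Phi,x)=1-\tau(\Phi,x)$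 always. *Decimation guided by $\tau$* sets $x_1,\dots,x_n$ one after another, $x_i$ being set to $1$ with probability $\tau(\Phi_{i-1},x_i)$ and to $0$ otherwise, where $\Phi_{i-1}$ is the reduced instance obtained after $x_1,\dots,x_{i-1}$ have been set. It *solves* $\Phi$ if its output satisfies $\Phi$. *Belief Propagation with $r$ iterations* on a reduced instance starts with all messages $\nu^0_{c\to x}(b)=\eta^0_{x\to c}(b)=1$ ($b\in\{0,1\}$, $x$ occurring in $c$) and updates simultaneously $$\eta^{t+1}_{x\to c}(b)=\prod_{c'\ni x,\,c'\ne c}\nu^{t}_{c'\to x}(b),\qquad \nu^{t+1}_{c\to x}(b)=\sum_{s}\ \prod_{y\in c,\,y\neq x}\eta^{t}_{y\to c}(s_y),$$ where $s$ ranges over the assignments of the variables of $c$ that satisfy $c$ and have $s_x=b$. The *BP rule with $r$ iterations* is $\tau(\Phi,x)=\frac{\mu}{\mu+1}=\frac{b_x(1)}{b_x(0)+b_x(1)}$, where $b_x(a)=\prod_{c\ni x}\nu^r_{c\to x}(a)$ and $\mu=b_x(1)/b_x(0)$. The *exact local marginal rule of depth $r$* ($r$ even) is the same with $b_x(a)$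 replaced by the number of satisfying assignments of $B_\Phi(x,r)$ that give $x$ the value $a$. In both cases $0/0$ is read as $1/2$. **Corollary.** For an integer $r>0$ let $r'$ be the least even integer with $r'\ge r$. 1. For every $r>0$, the BP rule with $r$ iterations and the exact local marginal rule of depth $r'$ are both $r'$-local and balanced. 2. There exists $K_0$ such that for every $K\ge K_0$, every real $d>2^{K-2}\ln 2$ and every integer $r>0$, $$\lim_{n\to\infty}\Pr\bigl(\text{BP-guided decimation with } r \text{ iterations solves }\Phi(n,dn)\bigr)=0 .$$ This holds both when the decimation is guided by the BP rule with $r$ iterations and when it is guided by the exact local marginal rule of depth $r'$. -/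

import Mathlib

namespace NAESat

/-- A (possibly reduced) NAE-SAT instance with variables in `V` and clauses indexed by `C`, given by
its labelled factor graph: `lit c v = some true` if the literal `v` occurs in the clause `c`,
`lit c v = some false` if the negated literal occurs, `lit c v = none` if `v` does not occur in `c`.
The sign of a clause is `0` for an original not-all-equal clause, `1` for a clause decorated `+`,
`-1` for a clause decorated `-`. A clause index without literals stands for a removed clause, and a
variable that has been assigned occurs in no clause. -/
structure Inst (V C : Type) where
  lit : C → V → Option Bool
  sign : C → SignType

/-- The value of a literal of polarity `p` (`true`: not negated) when its variable has value `b`. -/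
def litVal (p b : Bool) : Bool := p == b

namespace Inst

variable {V C : Type}

/-- The variable `v` occurs in the clause `c`. -/
def Occurs (Φ : Inst V C) (c : C) (v : V) : Prop := (Φ.lit c v).isSome = true

/-- Some literal of the clause `c` has value `a` under `σ`. -/
def HasLitOfValue (Φ : Inst V C) (σ : V → Bool) (c : C) (a : Bool) : Prop :=
  ∃ v p, Φ.lit c v = some p ∧ litVal p (σ v) = a

/-- `σ` satisfies the clause `c`: a `+` clause needs a literal of value `0`, a `-` clause needs a
literal of value `1`, an undecorated clause needs both. -/
def ClauseSat (Φ : Inst V C) (σ : V → Bool) (c : C) : Prop :=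
  (Φ.sign c ≠ -1 → Φ.HasLitOfValue σ c false) ∧ (Φ.sign c ≠ 1 → Φ.HasLitOfValue σ c true)

/-- `σ` satisfies the instance, that is, every clause that has not been removed. -/
def Sat (Φ : Inst V C) (σ : V → Bool) : Prop :=
  ∀ c, (∃ v, Φ.Occurs c v) → Φ.ClauseSat σ c

/-- The complement: the same literals, all signs flipped. -/
def compl (Φ : Inst V C) : Inst V C where
  lit := Φ.lit
  sign c := -Φ.sign c

/-- The decorated clause `c` contains the variable `x` and becomes satisfied when `x` is set
to `b`. (An undecorated clause is never satisfied by fixing a single variable.) -/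
def SatisfiedBy (Φ : Inst V C) (x : V) (b : Bool) (c : C) : Prop :=
  ∃ p, Φ.lit c x = some p ∧
    ((Φ.sign c = 1 ∧ litVal p b = false) ∨ (Φ.sign c = -1 ∧ litVal p b = true))

open Classical in
/-- The reduced instance obtained by setting `x` to `b`: the variable `x` is deleted, satisfied
clauses are removed, and an undecorated clause that contains `x` receives the sign `+` if its literal
on `x` has value `1` and the sign `-` if that literal has value `0`. A clause violated by this step
contained no other variable, so it has no literal left and thereby is removed as well. -/
noncomputable def assign (Φ : Inst V C) (x : V) (b : Bool) : Inst V C where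
  lit c v := if v = x ∨ Φ.SatisfiedBy x b c then none else Φ.lit c v
  sign c :=
    match Φ.lit c x with
    | none => Φ.sign c
    | some p => if Φ.sign c = 0 then (if litVal p b = true then 1 else -1) else Φ.sign c

/-- The bipartite factor graph on variables and clauses. -/
def factorGraph (Φ : Inst V C) : SimpleGraph (V ⊕ C) :=
  SimpleGraph.fromRel fun a b => ∃ v c, a = Sum.inl v ∧ b = Sum.inr c ∧ Φ.Occurs c v

/-- The variables at distance at most `r` from the variable `x` in the factor graph. -/
def BallVar (Φ : Inst V C) (x : V) (r : ℕ) : Type :=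
  {v : V // Φ.factorGraph.edist (Sum.inl x) (Sum.inl v) ≤ r}

/-- The clauses at distance at most `r` from the variable `x` in the factor graph. -/
def BallClause (Φ : Inst V C) (x : V) (r : ℕ) : Type :=
  {c : C // Φ.factorGraph.edist (Sum.inl x) (Sum.inr c) ≤ r}

/-- The root of the neighborhood. -/
def ballRoot (Φ : Inst V C) (x : V) (r : ℕ) : Φ.BallVar x r := ⟨x, by simp⟩

/-- The depth-`r` neighborhood `B(x, r)` in the factor graph, as an instance. It is used for even
`r`, where all variables of a clause of the neighborhood belong to the neighborhood. -/
def ball (Φ : Inst V C) (x : V) (r : ℕ) : Inst (Φ.BallVar x r) (Φ.BallClause x r) where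
  lit c v := Φ.lit c.1 v.1
  sign c := Φ.sign c.1

/-- Two instances with root variables are isomorphic as rooted decorated factor graphs. -/
def RootedIso {V' C' : Type} (Φ : Inst V C) (x : V) (Ψ : Inst V' C') (y : V') : Prop :=
  ∃ (e : V ≃ V') (f : C ≃ C'), e x = y ∧ (∀ c v, Ψ.lit (f c) (e v) = Φ.lit c v) ∧
    ∀ c, Ψ.sign (f c) = Φ.sign c

/-- The number of satisfying assignments in which the variable `x` has the value `b`. -/
noncomputable def numSat (Φ : Inst V C) (x : V) (b : Bool) : ℕ :=
  Nat.card {σ : V → Bool // Φ.Sat σ ∧ σ x = b}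

end Inst

/-- The fraction `a / (a + b)`, with the value `1/2` if `a = b = 0`. -/
noncomputable def fraction (a b : ℕ) : unitInterval :=
  if a + b = 0 then ⟨1 / 2, by norm_num, by norm_num⟩
  else ⟨(a : ℝ) / ((a : ℝ) + (b : ℝ)), by positivity, div_le_one_of_le₀ (by simp) (by positivity)⟩

/-- A decision rule: to every finite instance and every variable of it, the rule associates the
probability with which this variable is set to `1`. -/
def Rule : Type 1 :=
  ∀ (V C : Type) [Fintype V] [Fintype C], Inst V C → V → unitInterval

/-- The rule is `r`-local: its value at `x` is a function of the rooted instance `B(x, r)` alone. -/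
def Rule.IsLocal (r : ℕ) (τ : Rule) : Prop :=
  ∀ (V C V' C' : Type) [Fintype V] [Fintype C] [Fintype V'] [Fintype C']
    (Φ : Inst V C) (x : V) (Ψ : Inst V' C') (y : V'),
    (Φ.ball x r).RootedIso (Φ.ballRoot x r) (Ψ.ball y r) (Ψ.ballRoot y r) →
      τ V C Φ x = τ V' C' Ψ y

/-- The rule is balanced: complementing the instance exchanges the roles of `0` and `1`. -/
def Rule.IsBalanced (τ : Rule) : Prop :=
  ∀ (V C : Type) [Fintype V] [Fintype C] (Φ : Inst V C) (x : V),
    (τ V C Φ.compl x : ℝ) = 1 - (τ V C Φ x : ℝ)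

/-- The messages of Belief Propagation along the edges of the factor graph (only the values at pairs
`c`, `v` with `v` occurring in `c` are used). -/
structure Messages (V C : Type) where
  varToClause : V → C → Bool → ℕ
  clauseToVar : C → V → Bool → ℕ

section BP

variable {V C : Type} [Fintype V] [Fintype C]

open Classical in
/-- The assignments of values to the variables of the clause `c`, coded as functions on `V` that are
`false` off `c`, which satisfy `c` and give the value `b` to `v`. -/
noncomputable def clauseConfigs (Φ : Inst V C) (c : C) (v : V) (b : Bool) : Finset (V → Bool) :=
  Finset.univ.filter fun s => (∀ u, ¬ Φ.Occurs c u → s u = false) ∧ Φ.ClauseSat s c ∧ s v = b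

open Classical in
/-- The messages after `t` iterations of Belief Propagation (sum-product). All messages are uniform
initially, and in every iteration all of them are updated simultaneously. They are not normalized;
normalization does not change the marginals computed from them. -/
noncomputable def bpMessages (Φ : Inst V C) : ℕ → Messages V C
  | 0 => ⟨fun _ _ _ => 1, fun _ _ _ => 1⟩
  | t + 1 =>
    { varToClause := fun v c b =>
        ∏ c' ∈ Finset.univ.filter (fun c' => Φ.Occurs c' v ∧ c' ≠ c),
          (bpMessages Φ t).clauseToVar c' v b
      clauseToVar := fun c v b =>
        ∑ s ∈ clauseConfigs Φ c v b,
          ∏ u ∈ Finset.univ.filter (fun u => Φ.Occurs c u ∧ u ≠ v),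
            (bpMessages Φ t).varToClause u c (s u) }

open Classical in
/-- The (not normalized) belief of the variable `x` after `r` iterations. -/
noncomputable def bpBelief (Φ : Inst V C) (r : ℕ) (x : V) (b : Bool) : ℕ :=
  ∏ c ∈ Finset.univ.filter (fun c => Φ.Occurs c x), (bpMessages Φ r).clauseToVar c x b

end BP

/-- The rule of BP-guided decimation with `r` iterations: `x` is set to `1` with probability
`μ / (μ + 1)`, where `μ` is the ratio of the beliefs of the values `1` and `0`. -/
noncomputable def bpRule (r : ℕ) : Rule :=
  fun _ _ _ _ Φ x => fraction (bpBelief Φ r x true) (bpBelief Φ r x false)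

/-- The exact marginal of the neighborhood: `x` is set to `1` with probability `μ / (μ + 1)`, where
`μ` is the ratio of the numbers of satisfying assignments of the formula `B(x, r)` that set `x`
to `1` and to `0`. -/
noncomputable def marginalRule (r : ℕ) : Rule :=
  fun _ _ _ _ Φ x =>
    fraction ((Φ.ball x r).numSat (Φ.ballRoot x r) true)
      ((Φ.ball x r).numSat (Φ.ballRoot x r) false)

/-- The least even number that is at least `r`. -/
def evenDepth (r : ℕ) : ℕ := 2 * ((r + 1) / 2)

/-- A coin that shows `true` with probability `p`. -/
noncomputable def coin (p : unitInterval) : PMF Bool :=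
  PMF.ofFintype (fun b => if b = true then ENNReal.ofReal (p : ℝ) else ENNReal.ofReal (1 - (p : ℝ)))
    (by
      rw [Fintype.sum_bool, if_pos rfl, if_neg (by decide),
        ← ENNReal.ofReal_add p.2.1 (sub_nonneg.2 p.2.2)]
      simp)

open Classical in
/-- Decimation guided by the rule `τ`: the variables of the list are treated in this order; each one
is set to `1` with the probability that `τ` gives for the current reduced instance, and the instance
is reduced accordingly. The law of the resulting assignment; the last argument holds the values
assigned so far. -/
noncomputable def decimate {V C : Type} [Fintype V] [Fintype C] (τ : Rule) :
    List V → Inst V C → (V → Bool) → PMF (V → Bool)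
  | [], _, σ => PMF.pure σ
  | x :: xs, Φ, σ => (coin (τ V C Φ x)).bind fun b =>
      decimate τ xs (Φ.assign x b) (Function.update σ x b)

/-- The not-all-equal clauses on `K` distinct variables out of `x_1, …, x_n`, each of them negated
or not. -/
abbrev NAEClause (K n : ℕ) : Type :=
  {l : Fin n → Option Bool // (Finset.univ.filter fun v => (l v).isSome = true).card = K}

/-- A (non-reduced) formula with `m` clauses as an instance. -/
def toInst {K n m : ℕ} (F : Fin m → NAEClause K n) : Inst (Fin n) (Fin m) where
  lit c := (F c).1
  sign _ := 0

/-- The probability that decimation guided by `τ`, run in the order `x_1, …, x_n`, outputs a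
satisfying assignment of the random formula with `n` variables and `⌊d n⌋` clauses. The clauses are
independent and uniform (uniformly random `K` distinct variables with independent fair signs), that
is, the formula is uniform among all formulas; so this is an average over all formulas. -/
noncomputable def successProb (τ : Rule) (K : ℕ) (d : ℝ) (n : ℕ) : ENNReal :=
  (∑ F : Fin ⌊d * n⌋₊ → NAEClause K n,
      (decimate τ (List.finRange n) (toInst F) fun _ => false).toOuterMeasure
        {σ | (toInst F).Sat σ}) /
    (Fintype.card (Fin ⌊d * n⌋₊ → NAEClause K n) : ENNReal)

end NAESat

/-! Locality of Belief Propagation is a matter of tracking how far a message can see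
(`bpMessages_embedding`); balance follows by flipping all values. The limit holds for every
rational, local and balanced rule (`tendsto_successProb`) and rests on an obstruction for triples of
solutions.

Obstruction: for d > 2^(K-2) ln 2 a random formula has, with high probability, no three solutions at
pairwise distances between n/400 and n/100. Such triples have little more entropy than a single
assignment, about n ln 2. For large K, violation by one of them is almost disjoint from violation by
another, so a clause excludes the triple with probability close to 6/2^K, which costs about (3/2) n
ln 2 (`tendsto_expect_hasSpreadTriple`). Pairs would yield only the borderline cost n ln 2; hence
triples.

Coupling: decimation is a deterministic function of independent seeds, one per variable. Let three
runs share the seeds of the first t variables and be independent afterwards. By Jensen, all three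
succeed with probability at least the cube of the success probability. The mean distance of two
outputs is n/2 at t = 0, by balance, and 0 at t = n, and it moves in small steps; so for some t it
lies well inside the forbidden window. By Chebyshev the actual distances lie there too, so success
must be rare (`cube_expect_mem_le`).

Step size and variance are both controlled by the number of pairs of variables influenced by a
common seed. Influence travels along chains of nearby variables with increasing indices
(`run_eq_of_influences`). By symmetry a walk with l steps is increasing with chance at most
1/(l+1)!, which beats the growth of the neighborhoods, whose sizes have bounded exponential moments
(`sum_exp_reach_le`). Hence the expected number of such pairs is o(n²)
(`eventually_expect_interCount_le`). -/

namespace NAESat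

/-! ### Locality of Belief Propagation -/

namespace Inst

variable {V C V' C' : Type}

theorem ClauseSat.iff_of_embedding {Φ : Inst V C} {Ψ : Inst V' C'} {e : V' → V} {c : C} {c' : C'}
    (hl : ∀ v, Φ.lit c (e v) = Ψ.lit c' v) (hs : Φ.sign c = Ψ.sign c')
    (hr : ∀ v, Φ.Occurs c v → v ∈ Set.range e) {s : V → Bool} {s' : V' → Bool}
    (hss : ∀ v, Ψ.Occurs c' v → s (e v) = s' v) :
    Φ.ClauseSat s c ↔ Ψ.ClauseSat s' c' := by
  have key : ∀ a, Φ.HasLitOfValue s c a ↔ Ψ.HasLitOfValue s' c' a := by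
    intro a
    constructor
    · rintro ⟨v, p, hp, ha⟩
      obtain ⟨w, rfl⟩ := hr v (by simp [Occurs, hp])
      rw [hl] at hp
      refine ⟨w, p, hp, ?_⟩
      rw [← hss w (by simp [Occurs, hp])]
      exact ha
    · rintro ⟨v, p, hp, ha⟩
      refine ⟨e v, p, by rw [hl, hp], ?_⟩
      rw [hss v (by simp [Occurs, hp])]
      exact ha
  unfold ClauseSat
  rw [key, key, hs]

theorem factorGraph_adj_of_occurs (Φ : Inst V C) {c : C} {v : V} (h : Φ.Occurs c v) :
    Φ.factorGraph.Adj (Sum.inl v) (Sum.inr c) := by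
  rw [factorGraph, SimpleGraph.fromRel_adj]
  exact ⟨by simp, Or.inl ⟨v, c, rfl, rfl, h⟩⟩

theorem edist_succ_of_adj {α : Type} (G : SimpleGraph α) {x a b : α} (h : G.Adj a b) :
    G.edist x b ≤ G.edist x a + 1 := by
  have h1 : G.edist a b = 1 := SimpleGraph.edist_eq_one_iff_adj.2 h
  calc G.edist x b ≤ G.edist x a + G.edist a b := SimpleGraph.edist_triangle
    _ = _ := by rw [h1]

end Inst

section BP

variable {V C V' C' : Type} [Fintype V] [Fintype C] [Fintype V'] [Fintype C']

/-- The messages of an instance and of an instance embedded in it agree as long as they only depend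
on the common part; `dv` and `dc` bound the depths of variables and clauses. -/
theorem bpMessages_embedding {Φ : Inst V C} {Ψ : Inst V' C'} {e : V' → V} {f : C' → C}
    (he : e.Injective) (hf : f.Injective) (hl : ∀ c v, Φ.lit (f c) (e v) = Ψ.lit c v)
    (hs : ∀ c, Φ.sign (f c) = Ψ.sign c) (dv : V' → ℕ) (dc : C' → ℕ) (R : ℕ)
    (hcv : ∀ c, dc c + 1 ≤ R → ∀ v, Φ.Occurs (f c) v → v ∈ Set.range e)
    (hdv : ∀ c v, Ψ.Occurs c v → dv v ≤ dc c + 1)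
    (hvc : ∀ v, dv v + 1 ≤ R → ∀ c, Φ.Occurs c (e v) → c ∈ Set.range f)
    (hdc : ∀ c v, Ψ.Occurs c v → dc c ≤ dv v + 1) (t : ℕ) :
    (∀ c v b, Ψ.Occurs c v → dc c + 2 * ((t + 1) / 2) ≤ R + 1 →
      (bpMessages Φ t).clauseToVar (f c) (e v) b = (bpMessages Ψ t).clauseToVar c v b) ∧
    (∀ c v b, Ψ.Occurs c v → dv v + 2 * (t / 2) ≤ R →
      (bpMessages Φ t).varToClause (e v) (f c) b = (bpMessages Ψ t).varToClause v c b) := by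
  classical
  have hocc : ∀ c v, Φ.Occurs (f c) (e v) ↔ Ψ.Occurs c v := fun c v => by
    simp [Inst.Occurs, hl]
  induction t with
  | zero => exact ⟨fun _ _ _ _ _ => rfl, fun _ _ _ _ _ => rfl⟩
  | succ t ih =>
    obtain ⟨ih1, ih2⟩ := ih
    constructor
    · intro c v b hv hd
      have hd1 : dc c + 1 ≤ R := by omega
      have hr := hcv c hd1
      simp only [bpMessages]
      have hset : (Finset.univ.filter fun u => Φ.Occurs (f c) u ∧ u ≠ e v) =
          (Finset.univ.filter fun u => Ψ.Occurs c u ∧ u ≠ v).image e := by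
        ext u
        simp only [Finset.mem_filter, Finset.mem_univ, true_and, Finset.mem_image]
        constructor
        · rintro ⟨h1, h2⟩
          obtain ⟨w, rfl⟩ := hr u h1
          exact ⟨w, ⟨(hocc c w).1 h1, fun h => h2 (by rw [h])⟩, rfl⟩
        · rintro ⟨w, ⟨h1, h2⟩, rfl⟩
          exact ⟨(hocc c w).2 h1, fun h => h2 (he h)⟩
      -- Configurations are `false` off the clause, so extension by `false` inverts restriction.
      refine Finset.sum_bij' (fun s _ => s ∘ e) (fun s _ => Function.extend e s fun _ => false)
        ?_ ?_ ?_ ?_ ?_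
      · intro s hsm
        simp only [clauseConfigs, Finset.mem_filter, Finset.mem_univ, true_and] at hsm ⊢
        refine ⟨fun u hu => hsm.1 _ (by rwa [hocc]), ?_, hsm.2.2⟩
        exact (Inst.ClauseSat.iff_of_embedding (hl c) (hs c) hr fun _ _ => rfl).1 hsm.2.1
      · intro s hsm
        simp only [clauseConfigs, Finset.mem_filter, Finset.mem_univ, true_and] at hsm ⊢
        refine ⟨fun u hu => ?_, ?_, ?_⟩
        · by_cases h : ∃ w, e w = u
          · obtain ⟨w, rfl⟩ := h
            rw [he.extend_apply]
            exact hsm.1 _ (by rwa [← hocc])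
          · rw [Function.extend_apply' _ _ _ h]
        · exact (Inst.ClauseSat.iff_of_embedding (hl c) (hs c) hr
            fun w _ => he.extend_apply _ _ _).2 hsm.2.1
        · rw [he.extend_apply]; exact hsm.2.2
      · intro s hsm
        simp only [clauseConfigs, Finset.mem_filter, Finset.mem_univ, true_and] at hsm
        funext u
        by_cases h : ∃ w, e w = u
        · obtain ⟨w, rfl⟩ := h
          rw [he.extend_apply]; rfl
        · rw [Function.extend_apply' _ _ _ h]
          exact (hsm.1 u fun ho => h (hr u ho)).symm
      · intro s _
        funext u
        exact he.extend_apply _ _ _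
      · intro s _
        rw [hset, Finset.prod_image he.injOn]
        refine Finset.prod_congr rfl fun u hu => ?_
        simp only [Finset.mem_filter, Finset.mem_univ, true_and] at hu
        have := hdv c u hu.1
        exact ih2 c u _ hu.1 (by omega)
    · intro c v b hv hd
      simp only [bpMessages]
      -- After one update the message of a variable is a product of ones, whatever its clauses are.
      -- Boundary variables therefore need not see their clauses, which is why the depths are
      -- rounded as `2 * (t / 2)` and `2 * ((t + 1) / 2)`.
      rcases Nat.eq_zero_or_pos t with rfl | ht
      · simp [bpMessages]
      · have hd1 : dv v + 1 ≤ R := by omega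
        have hset : (Finset.univ.filter fun a => Φ.Occurs a (e v) ∧ a ≠ f c) =
            (Finset.univ.filter fun a => Ψ.Occurs a v ∧ a ≠ c).image f := by
          ext u
          simp only [Finset.mem_filter, Finset.mem_univ, true_and, Finset.mem_image]
          constructor
          · rintro ⟨h1, h2⟩
            obtain ⟨w, rfl⟩ := hvc v hd1 u h1
            exact ⟨w, ⟨(hocc w v).1 h1, fun h => h2 (by rw [h])⟩, rfl⟩
          · rintro ⟨w, ⟨h1, h2⟩, rfl⟩
            exact ⟨(hocc w v).2 h1, fun h => h2 (hf h)⟩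
        rw [hset, Finset.prod_image hf.injOn]
        refine Finset.prod_congr rfl fun a ha => ?_
        simp only [Finset.mem_filter, Finset.mem_univ, true_and] at ha
        have := hdc a v ha.1
        exact ih1 a v _ ha.1 (by omega)

theorem bpBelief_embedding {Φ : Inst V C} {Ψ : Inst V' C'} {e : V' → V} {f : C' → C}
    (he : e.Injective) (hf : f.Injective) (hl : ∀ c v, Φ.lit (f c) (e v) = Ψ.lit c v)
    (hs : ∀ c, Φ.sign (f c) = Ψ.sign c) (dv : V' → ℕ) (dc : C' → ℕ) (R : ℕ)
    (hcv : ∀ c, dc c + 1 ≤ R → ∀ v, Φ.Occurs (f c) v → v ∈ Set.range e)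
    (hdv : ∀ c v, Ψ.Occurs c v → dv v ≤ dc c + 1)
    (hvc : ∀ v, dv v + 1 ≤ R → ∀ c, Φ.Occurs c (e v) → c ∈ Set.range f)
    (hdc : ∀ c v, Ψ.Occurs c v → dc c ≤ dv v + 1) {r : ℕ} (hr : 0 < r)
    (hR : 2 * ((r + 1) / 2) ≤ R) {x : V'} (hx : dv x = 0) (b : Bool) :
    bpBelief Φ r (e x) b = bpBelief Ψ r x b := by
  classical
  have hset : (Finset.univ.filter fun a => Φ.Occurs a (e x)) =
      (Finset.univ.filter fun a => Ψ.Occurs a x).image f := by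
    ext u
    simp only [Finset.mem_filter, Finset.mem_univ, true_and, Finset.mem_image]
    constructor
    · intro h1
      obtain ⟨w, rfl⟩ := hvc x (by omega) u h1
      exact ⟨w, by simpa [Inst.Occurs, hl] using h1, rfl⟩
    · rintro ⟨w, h1, rfl⟩
      simpa [Inst.Occurs, hl] using h1
  unfold bpBelief
  rw [hset, Finset.prod_image hf.injOn]
  refine Finset.prod_congr rfl fun a ha => ?_
  simp only [Finset.mem_filter, Finset.mem_univ, true_and] at ha
  have := hdc a x ha
  exact (bpMessages_embedding he hf hl hs dv dc R hcv hdv hvc hdc r).1 a x b ha (by omega)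

theorem bpBelief_of_rootedIso {Φ : Inst V C} {x : V} {Ψ : Inst V' C'} {y : V'} {r : ℕ} (hr : 0 < r)
    (h : Φ.RootedIso x Ψ y) (b : Bool) : bpBelief Φ r x b = bpBelief Ψ r y b := by
  obtain ⟨e, f, rfl, hl, hs⟩ := h
  exact (bpBelief_embedding e.injective f.injective hl hs (fun _ => 0) (fun _ => 0)
    (2 * ((r + 1) / 2)) (fun _ _ v _ => e.surjective v) (fun _ _ _ => Nat.zero_le _)
    (fun _ _ c _ => f.surjective c) (fun _ _ _ => Nat.zero_le _) hr le_rfl rfl b).symm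

noncomputable instance (Φ : Inst V C) (x : V) (r : ℕ) : Fintype (Φ.BallVar x r) := by
  classical exact inferInstanceAs (Fintype {v : V // _})

noncomputable instance (Φ : Inst V C) (x : V) (r : ℕ) : Fintype (Φ.BallClause x r) := by
  classical exact inferInstanceAs (Fintype {v : C // _})

/-- Distance from the root serves as depth. The ball misses clauses only at variables of the maximal
depth, where no message depends on them. -/
theorem bpBelief_ball (Φ : Inst V C) (x : V) {r : ℕ} (hr : 0 < r) (b : Bool) :
    bpBelief Φ r x b =
      bpBelief (Φ.ball x (evenDepth r)) r (Φ.ballRoot x (evenDepth r)) b := by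
  set R := evenDepth r with hR
  have lift : ∀ {a : V ⊕ C}, Φ.factorGraph.edist (Sum.inl x) a ≤ R →
      ((Φ.factorGraph.edist (Sum.inl x) a).toNat : ℕ∞) = Φ.factorGraph.edist (Sum.inl x) a :=
    fun h => ENat.natCast_toNat (ne_top_of_le_ne_top (by simp) h)
  have step : ∀ {a c : V ⊕ C} {k : ℕ}, Φ.factorGraph.Adj a c →
      Φ.factorGraph.edist (Sum.inl x) a ≤ R →
      (Φ.factorGraph.edist (Sum.inl x) a).toNat + 1 ≤ k →
      Φ.factorGraph.edist (Sum.inl x) c ≤ k := by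
    intro a c k hac ha hk
    refine (Inst.edist_succ_of_adj _ hac).trans ?_
    rw [← lift ha]
    exact_mod_cast hk
  refine bpBelief_embedding (Φ := Φ) (Ψ := Φ.ball x R) (x := Φ.ballRoot x R)
    (e := fun v : Φ.BallVar x R => v.1) (f := fun c : Φ.BallClause x R => c.1)
    (fun _ _ h => Subtype.ext h) (fun _ _ h => Subtype.ext h) (fun _ _ => rfl) (fun _ => rfl)
    (fun v => (Φ.factorGraph.edist (Sum.inl x) (Sum.inl v.1)).toNat)
    (fun c => (Φ.factorGraph.edist (Sum.inl x) (Sum.inr c.1)).toNat) R ?_ ?_ ?_ ?_ hr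
    (by rw [hR, evenDepth]) (by simp [Inst.ballRoot]) b
  · intro c hc v hv
    exact ⟨⟨v, step (Φ.factorGraph_adj_of_occurs hv).symm c.2 hc⟩, rfl⟩
  · intro c v hv
    have := step (k := _) (Φ.factorGraph_adj_of_occurs (c := c.1) (v := v.1) hv).symm c.2 le_rfl
    rw [← lift v.2] at this
    exact_mod_cast this
  · intro v hv' c hc
    exact ⟨⟨c, step (Φ.factorGraph_adj_of_occurs hc) v.2 hv'⟩, rfl⟩
  · intro c v hv
    have := step (k := _) (Φ.factorGraph_adj_of_occurs (c := c.1) (v := v.1) hv) v.2 le_rfl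
    rw [← lift c.2] at this
    exact_mod_cast this

end BP

theorem bpRule_isLocal {r : ℕ} (hr : 0 < r) : (bpRule r).IsLocal (evenDepth r) := by
  intro V C V' C' _ _ _ _ Φ x Ψ y h
  have key : ∀ b, bpBelief Φ r x b = bpBelief Ψ r y b := fun b => by
    rw [bpBelief_ball Φ x hr, bpBelief_ball Ψ y hr, bpBelief_of_rootedIso hr h]
  simp only [bpRule, key]

theorem fraction_comm (a b : ℕ) : (fraction b a : ℝ) = 1 - fraction a b := by
  unfold fraction
  rw [add_comm b a]
  split_ifs with h
  · norm_num
  · have : (a : ℝ) + b ≠ 0 := by exact_mod_cast h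
    simp only
    rw [add_comm (b : ℝ) a]
    field_simp
    ring

/-- Rationality allows the coins to be simulated by finitely many equally likely seeds. -/
theorem exists_rat_eq_fraction (a b : ℕ) : ∃ q : ℚ, (fraction a b : ℝ) = q := by
  unfold fraction
  split_ifs with h
  · exact ⟨1 / 2, by norm_num⟩
  · exact ⟨a / (a + b), by push_cast; rfl⟩

/-! ### Symmetry under complementation -/

section Balanced

variable {V C : Type}

theorem litVal_not (p b : Bool) : litVal p (!b) = !litVal p b := by
  cases p <;> cases b <;> rfl

theorem Inst.ClauseSat.compl_iff {Φ : Inst V C} {c : C} {s s' : V → Bool}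
    (hss : ∀ v, Φ.Occurs c v → s' v = !s v) :
    Φ.compl.ClauseSat s' c ↔ Φ.ClauseSat s c := by
  have key : ∀ a, Φ.compl.HasLitOfValue s' c a ↔ Φ.HasLitOfValue s c (!a) := by
    intro a
    refine exists_congr fun v => exists_congr fun p => and_congr_right fun hp => ?_
    have hp' : Φ.lit c v = some p := hp
    rw [hss v (by simp [Inst.Occurs, hp']), litVal_not]
    cases a <;> simp
  unfold Inst.ClauseSat
  rw [key, key]
  have h1 : Φ.compl.sign c = -Φ.sign c := rfl
  rw [h1, Bool.not_false, Bool.not_true, and_comm]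
  generalize Φ.sign c = s
  cases s <;> simp

theorem Inst.Sat.compl_iff {Φ : Inst V C} {s : V → Bool} :
    Φ.compl.Sat (fun v => !s v) ↔ Φ.Sat s :=
  forall_congr' fun _ => imp_congr Iff.rfl (Inst.ClauseSat.compl_iff fun _ _ => rfl)

theorem Inst.numSat_compl (Φ : Inst V C) (x : V) (b : Bool) :
    Φ.compl.numSat x b = Φ.numSat x (!b) := by
  refine Nat.card_congr
    { toFun := fun σ => ⟨fun v => !σ.1 v, ?_, ?_⟩
      invFun := fun σ => ⟨fun v => !σ.1 v, ?_, ?_⟩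
      left_inv := fun σ => by simp
      right_inv := fun σ => by simp }
  · rw [← Inst.Sat.compl_iff]; simpa using σ.2.1
  · simp [σ.2.2]
  · exact Inst.Sat.compl_iff.2 σ.2.1
  · simp [σ.2.2]

theorem Inst.numSat_of_rootedIso {V' C' : Type} {Φ : Inst V C} {x : V} {Ψ : Inst V' C'} {y : V'}
    (h : Φ.RootedIso x Ψ y) (b : Bool) : Φ.numSat x b = Ψ.numSat y b := by
  obtain ⟨e, f, rfl, hl, hs⟩ := h
  refine Nat.card_congr ((e.arrowCongr (Equiv.refl Bool)).subtypeEquiv fun σ => ?_)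
  refine and_congr ?_ (by simp [Equiv.arrowCongr])
  unfold Inst.Sat
  rw [← f.forall_congr_right]
  refine forall_congr' fun c => imp_congr ?_ ?_
  · rw [← e.exists_congr_right]
    simp [Inst.Occurs, hl]
  · refine (Inst.ClauseSat.iff_of_embedding (e := e) (hl c) (hs c)
      (fun v _ => e.surjective v) fun v _ => ?_).symm
    simp [Equiv.arrowCongr]

theorem marginalRule_isLocal (r : ℕ) : (marginalRule r).IsLocal r := by
  intro V C V' C' _ _ _ _ Φ x Ψ y h
  simp only [marginalRule, Inst.numSat_of_rootedIso h]

theorem marginalRule_isBalanced (r : ℕ) : (marginalRule r).IsBalanced := by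
  intro V C _ _ Φ x
  simp only [marginalRule]
  rw [← fraction_comm]
  have h : ∀ b, (Φ.compl.ball x r).numSat (Φ.compl.ballRoot x r) b =
      (Φ.ball x r).numSat (Φ.ballRoot x r) (!b) := fun b =>
    Inst.numSat_compl (Φ.ball x r) (Φ.ballRoot x r) b
  rw [h, h]
  rfl

theorem bpMessages_compl [Fintype V] [Fintype C] (Φ : Inst V C) (t : ℕ) :
    (∀ c v b, Φ.Occurs c v → (bpMessages Φ.compl t).clauseToVar c v b =
      (bpMessages Φ t).clauseToVar c v (!b)) ∧
    (∀ v c b, (bpMessages Φ.compl t).varToClause v c b =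
      (bpMessages Φ t).varToClause v c (!b)) := by
  classical
  induction t with
  | zero => exact ⟨fun _ _ _ _ => rfl, fun _ _ _ => rfl⟩
  | succ t ih =>
    constructor
    · intro c v b hv
      simp only [bpMessages]
      have mem : ∀ (s : V → Bool) (b : Bool) (Ψ : Inst V C), s ∈ clauseConfigs Ψ c v b ↔
          (∀ u, ¬ Ψ.Occurs c u → s u = false) ∧ Ψ.ClauseSat s c ∧ s v = b := by
        intro s b Ψ
        simp [clauseConfigs]
      have hocc : ∀ u, Φ.compl.Occurs c u ↔ Φ.Occurs c u := fun _ => Iff.rfl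
      -- Configurations must stay `false` off the clause, so only variables of the clause are
      -- flipped.
      set g : (V → Bool) → V → Bool := fun s u => if Φ.Occurs c u then !s u else false with hg
      have hgg : ∀ s : V → Bool, (∀ u, ¬ Φ.Occurs c u → s u = false) → g (g s) = s := by
        intro s hsu
        funext u
        by_cases h : Φ.Occurs c u
        · simp [hg, h]
        · simp [hg, h, hsu u h]
      refine Finset.sum_bij' (fun s _ => g s) (fun s _ => g s) ?_ ?_ ?_ ?_ ?_
      · intro s hsm
        rw [mem] at hsm ⊢
        refine ⟨fun u hu => by simp [hg, hu], ?_, by simp [hg, hv, hsm.2.2]⟩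
        exact (Inst.ClauseSat.compl_iff (s := g s) fun u hu => by simp [hg, hu]).1 hsm.2.1
      · intro s hsm
        rw [mem] at hsm ⊢
        refine ⟨fun u hu => if_neg hu, ?_, by simp [hg, hv, hsm.2.2]⟩
        exact (Inst.ClauseSat.compl_iff fun u hu => by simp [hg, hu]).2 hsm.2.1
      · intro s hsm
        exact hgg s ((mem _ _ _).1 hsm).1
      · intro s hsm
        exact hgg s ((mem _ _ _).1 hsm).1
      · intro s _
        refine Finset.prod_congr rfl fun u hu => ?_
        have hu' : Φ.Occurs c u := (Finset.mem_filter.1 hu).2.1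
        rw [ih.2]
        simp [hg, hu']
    · intro v c b
      simp only [bpMessages]
      exact Finset.prod_congr rfl fun a ha => ih.1 a v b (Finset.mem_filter.1 ha).2.1

theorem bpRule_isBalanced (r : ℕ) : (bpRule r).IsBalanced := by
  classical
  intro V C _ _ Φ x
  simp only [bpRule]
  rw [← fraction_comm]
  have h : ∀ b, bpBelief Φ.compl r x b = bpBelief Φ r x (!b) := fun b =>
    Finset.prod_congr rfl fun a ha => (bpMessages_compl Φ r).1 a x b (Finset.mem_filter.1 ha).2
  rw [h, h]
  rfl

end Balanced

/-! ### Coupled runs and the distance of their outputs -/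

section Coupling

open Finset BigOperators

variable {ι Ω κ : Type} [Fintype ι] [DecidableEq ι] [Fintype Ω] [Fintype κ] [DecidableEq κ]

theorem expect_prod {α β : Type} [Fintype α] [Fintype β] (f : α × β → ℝ) :
    𝔼 p, f p = 𝔼 a, 𝔼 b, f (a, b) := by
  rw [← univ_product_univ, expect_product]

/-- Seeds of coupled runs: a shared seed and one private seed for each run. -/
abbrev Seeds (ι Ω κ : Type) : Type := (ι → Ω) × (κ → ι → Ω)

/-- The two families of seeds agree on `A`. -/
def Seeds.EqOn (A : Finset ι) (p q : Seeds ι Ω κ) : Prop :=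
  ∀ i ∈ A, p.1 i = q.1 i ∧ ∀ k, p.2 k i = q.2 k i

/-- The seeds that agree with `p` on `A` and with `q` off `A`. -/
def Seeds.glue (A : Finset ι) (p q : Seeds ι Ω κ) : Seeds ι Ω κ :=
  (A.piecewise p.1 q.1, fun k => A.piecewise (p.2 k) (q.2 k))

/-- Exchange of two families of seeds off `A`. -/
def Seeds.swapOff (A : Finset ι) :
    (Seeds ι Ω κ × Seeds ι Ω κ) ≃ (Seeds ι Ω κ × Seeds ι Ω κ) where
  toFun p := (Seeds.glue A p.1 p.2, Seeds.glue A p.2 p.1)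
  invFun p := (Seeds.glue A p.1 p.2, Seeds.glue A p.2 p.1)
  left_inv p := by
    refine Prod.ext (Prod.ext ?_ ?_) (Prod.ext ?_ ?_) <;> funext i <;>
      (try funext k) <;> simp only [Seeds.glue, Finset.piecewise] <;> split_ifs <;> rfl
  right_inv p := by
    refine Prod.ext (Prod.ext ?_ ?_) (Prod.ext ?_ ?_) <;> funext i <;>
      (try funext k) <;> simp only [Seeds.glue, Finset.piecewise] <;> split_ifs <;> rfl

/-- Exchanging two independent families of seeds off `A` preserves the uniform law. It keeps what
`g` sees of the first family and replaces what `h` sees of it by the second one. -/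
theorem expect_mul_of_disjoint [Nonempty Ω] {A B : Finset ι} (hAB : Disjoint A B) {g h : Seeds ι Ω κ → ℝ}
    (hg : ∀ p q, Seeds.EqOn A p q → g p = g q) (hh : ∀ p q, Seeds.EqOn B p q → h p = h q) :
    𝔼 p, g p * h p = (𝔼 p, g p) * 𝔼 p, h p := by
  have h1 : (𝔼 p, g p) * 𝔼 p, h p =
      𝔼 p : Seeds ι Ω κ × Seeds ι Ω κ, g p.1 * h p.2 := by
    rw [Fintype.expect_mul_expect, expect_prod (fun p : Seeds ι Ω κ × Seeds ι Ω κ => g p.1 * h p.2)]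
  have h2 : (𝔼 p : Seeds ι Ω κ × Seeds ι Ω κ, g p.1 * h p.2) =
      𝔼 p : Seeds ι Ω κ × Seeds ι Ω κ, g p.1 * h p.1 := by
    refine Fintype.expect_equiv (Seeds.swapOff A) _ _ fun p => ?_
    congr 1
    · refine hg _ _ fun i hi => ?_
      simp [Seeds.swapOff, Seeds.glue, Finset.piecewise, hi]
    · refine hh _ _ fun i hi => ?_
      have : i ∉ A := Finset.disjoint_right.1 hAB hi
      simp [Seeds.swapOff, Seeds.glue, Finset.piecewise, this]
  rw [h1, h2, expect_prod (fun p : Seeds ι Ω κ × Seeds ι Ω κ => g p.1 * h p.1)]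
  simp only [expect_const univ_nonempty]

/-- The variance of a sum of `[0,1]`-valued functions is at most the number of pairs with
intersecting supports. -/
theorem variance_sum_le [Nonempty Ω] {J : Type} [Fintype J] (A : J → Finset ι) (X : J → Seeds ι Ω κ → ℝ)
    (hX : ∀ j p, 0 ≤ X j p ∧ X j p ≤ 1) (hA : ∀ j p q, Seeds.EqOn (A j) p q → X j p = X j q) :
    𝔼 p, (∑ j, X j p - 𝔼 q, ∑ j, X j q) ^ 2 ≤
      #{jk : J × J | ¬ Disjoint (A jk.1) (A jk.2)} := by
  set Y : J → Seeds ι Ω κ → ℝ := fun j p => X j p - 𝔼 q, X j q with hY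
  have hE : ∀ j, 0 ≤ 𝔼 q, X j q ∧ 𝔼 q, X j q ≤ 1 := fun j =>
    ⟨expect_nonneg fun p _ => (hX j p).1, expect_le univ_nonempty fun p _ => (hX j p).2⟩
  have hY0 : ∀ j, 𝔼 p, Y j p = 0 := fun j => by
    simp only [hY]
    rw [expect_sub_distrib, expect_const univ_nonempty, sub_self]
  have hYA : ∀ j p q, Seeds.EqOn (A j) p q → Y j p = Y j q := fun j p q h => by
    simp only [hY, hA j p q h]
  have hY1 : ∀ j p, |Y j p| ≤ 1 := fun j p => by
    rw [abs_le]
    have := hX j p; have := hE j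
    constructor <;> simp only [hY] <;> linarith
  have e1 : ∀ p, (∑ j, X j p - 𝔼 q, ∑ j, X j q) ^ 2 = ∑ jk : J × J, Y jk.1 p * Y jk.2 p := by
    intro p
    rw [expect_sum_comm, ← sum_sub_distrib, sq, sum_mul_sum,
      Fintype.sum_prod_type]
  simp only [e1]
  rw [expect_sum_comm, Finset.card_filter]
  push_cast
  -- Disjoint supports give covariance zero; every other covariance is at most one.
  refine sum_le_sum fun jk _ => ?_
  by_cases h : Disjoint (A jk.1) (A jk.2)
  · rw [expect_mul_of_disjoint h (hYA _) (hYA _), hY0, zero_mul, if_neg (not_not.2 h)]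
  · rw [if_pos h]
    refine expect_le univ_nonempty fun p _ => (le_abs_self _).trans ?_
    rw [abs_mul]
    exact mul_le_one₀ (hY1 _ _) (abs_nonneg _) (hY1 _ _)

theorem chebyshev_expect {T : Type} [Fintype T] [Nonempty T] (D : T → ℝ) {δ V : ℝ} (hδ : 0 < δ)
    (hV : 𝔼 p, (D p - 𝔼 q, D q) ^ 2 ≤ V) :
    𝔼 p, (if δ ≤ |D p - 𝔼 q, D q| then (1 : ℝ) else 0) ≤ V / δ ^ 2 := by
  rw [le_div_iff₀ (by positivity), expect_mul]
  refine le_trans (expect_le_expect fun p _ => ?_) hV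
  split_ifs with h
  · rw [one_mul, ← sq_abs (D p - _)]
    gcongr
  · rw [zero_mul]; positivity

/-- The seed of run `k` when the runs share their seeds at the indices less than `t`. -/
def sharedSeed {n : ℕ} (t : ℕ) (p : Seeds (Fin n) Ω κ) (k : κ) : Fin n → Ω :=
  fun i => if i.val < t then p.1 i else p.2 k i

/-- Given the shared seeds the three runs are independent with the same law, so the right side is
the mean of the cube of a conditional expectation, and Jensen applies. -/
theorem cube_expect_le [Nonempty Ω] {n : ℕ} (t : ℕ) (g : (Fin n → Ω) → ℝ) (hg : ∀ u, 0 ≤ g u) :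
    (𝔼 u, g u) ^ 3 ≤ 𝔼 p : Seeds (Fin n) Ω (Fin 3), ∏ k, g (sharedSeed t p k) := by
  set mix : (Fin n → Ω) → (Fin n → Ω) → Fin n → Ω :=
    fun z y i => if i.val < t then z i else y i with hmix
  have h1 : (𝔼 u, g u) = 𝔼 z, 𝔼 y, g (mix z y) := by
    have e : (𝔼 p : (Fin n → Ω) × (Fin n → Ω), g (mix p.1 p.2)) =
        𝔼 p : (Fin n → Ω) × (Fin n → Ω), g p.1 := by
      refine Fintype.expect_equiv
        ⟨fun p => (mix p.1 p.2, mix p.2 p.1), fun p => (mix p.1 p.2, mix p.2 p.1), ?_, ?_⟩ _ _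
        fun p => rfl
      all_goals
        intro p
        refine Prod.ext ?_ ?_ <;> funext i <;> simp only [hmix] <;> split_ifs <;> rfl
    rw [expect_prod, expect_prod] at e
    simp only [expect_const univ_nonempty] at e
    exact e.symm
  have h2 : (𝔼 p : Seeds (Fin n) Ω (Fin 3), ∏ k, g (sharedSeed t p k)) =
      𝔼 z, (𝔼 y, g (mix z y)) ^ 3 := by
    rw [expect_prod]
    refine expect_congr rfl fun z _ => ?_
    rw [Fintype.expect_eq_sum_div_card, Fintype.expect_eq_sum_div_card, div_pow, Fintype.sum_pow,
      Fintype.card_fun, Fintype.card_fin, Nat.cast_pow]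
    rfl
  rw [h1, h2, Fintype.expect_eq_sum_div_card (fun z => 𝔼 y, g (mix z y)),
    Fintype.expect_eq_sum_div_card]
  have h3 := pow_sum_div_card_le_sum_pow (s := univ) (f := fun z => 𝔼 y, g (mix z y))
    (fun z _ => expect_nonneg fun _ _ => hg _) 2
  rw [card_univ] at h3
  have hc : (0 : ℝ) < Fintype.card (Fin n → Ω) := by exact_mod_cast Fintype.card_pos
  rw [le_div_iff₀ hc]
  refine le_trans (le_of_eq ?_) h3
  field_simp

/-- The expected distance of the outputs of runs `k` and `l` that share `t` seeds. -/
noncomputable def meanDist {n : ℕ} (f : (Fin n → Ω) → Fin n → Bool) (t : ℕ) (k l : κ) : ℝ :=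
  𝔼 p : Seeds (Fin n) Ω κ, (hammingDist (f (sharedSeed t p k)) (f (sharedSeed t p l)) : ℝ)

theorem hammingDist_eq_sum {n : ℕ} (σ σ' : Fin n → Bool) :
    (hammingDist σ σ' : ℝ) = ∑ j, if σ j ≠ σ' j then (1 : ℝ) else 0 := by
  rw [hammingDist, Finset.card_filter]
  push_cast
  rfl

theorem meanDist_perm {n : ℕ} (f : (Fin n → Ω) → Fin n → Bool) (t : ℕ) (k l : κ)
    (π : Equiv.Perm κ) : meanDist f t (π k) (π l) = meanDist f t k l := by
  refine Fintype.expect_equiv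
    ((Equiv.refl _).prodCongr (Equiv.arrowCongr π.symm (Equiv.refl (Fin n → Ω)))) _ _ fun p => ?_
  have h : ∀ k, sharedSeed t p (π k) = sharedSeed t
      (((Equiv.refl _).prodCongr (Equiv.arrowCongr π.symm (Equiv.refl (Fin n → Ω)))) p) k := by
    intro k
    funext i
    simp [sharedSeed]
  rw [h, h]

theorem meanDist_all {n : ℕ} (f : (Fin n → Ω) → Fin n → Bool) (k l : κ) :
    meanDist f n k l = 0 := by
  refine expect_eq_zero fun p _ => ?_
  have h : ∀ k, sharedSeed n p k = p.1 := fun k => by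
    funext i
    simp [sharedSeed]
  rw [h, h, hammingDist_self, Nat.cast_zero]

/-- With nothing shared, applying `e` to the private seeds of run `l` alone preserves the law and
complements one of the two outputs, which turns a distance `h` into `n - h`. -/
theorem meanDist_zero [Nonempty Ω] {n : ℕ} (f : (Fin n → Ω) → Fin n → Bool) (e : Equiv.Perm Ω)
    (he : ∀ u j, f (fun i => e (u i)) j = !f u j) {k l : κ} (hkl : k ≠ l) :
    meanDist f 0 k l = n / 2 := by
  have h0 : ∀ (p : Seeds (Fin n) Ω κ) k, sharedSeed 0 p k = p.2 k := fun p k => by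
    funext i
    simp [sharedSeed]
  have hflip : ∀ σ σ' : Fin n → Bool, (hammingDist σ (fun j => !σ' j) : ℝ) =
      n - hammingDist σ σ' := by
    intro σ σ'
    have : (n : ℝ) = ∑ _j : Fin n, (1 : ℝ) := by simp
    rw [hammingDist_eq_sum, hammingDist_eq_sum, this, ← sum_sub_distrib]
    refine sum_congr rfl fun j _ => ?_
    cases σ j <;> cases σ' j <;> simp
  have h1 : meanDist f 0 k l = n - meanDist f 0 k l := by
    have h2 : ((n : ℝ) - meanDist f 0 k l) = 𝔼 p : Seeds (Fin n) Ω κ,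
        ((n : ℝ) - hammingDist (f (p.2 k)) (f (p.2 l))) := by
      rw [expect_sub_distrib, expect_const univ_nonempty, meanDist]
      simp only [h0]
    rw [h2, meanDist]
    refine (Fintype.expect_equiv ((Equiv.refl (Fin n → Ω)).prodCongr (Equiv.piCongrRight
      fun k' => if k' = l then Equiv.piCongrRight fun _ => e else Equiv.refl _)) _ _
      fun p => ?_).symm
    rw [h0, h0, ← hflip]
    congr 2
    · simp [hkl]
    · funext j
      rw [← he]
      simp
      rfl
  linarith

/-- Only the seed at `t` is replaced, so only coordinates whose support contains `t` can change. -/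
theorem abs_meanDist_succ_sub_le [Nonempty Ω] {n : ℕ} (f : (Fin n → Ω) → Fin n → Bool)
    (A : Fin n → Finset (Fin n)) (hA : ∀ j u v, (∀ i ∈ A j, u i = v i) → f u j = f v j)
    (t : Fin n) (k l : κ) :
    |meanDist f (t + 1) k l - meanDist f t k l| ≤ #{j | t ∈ A j} := by
  rw [meanDist, meanDist, ← expect_sub_distrib]
  refine (abs_expect_le _ _).trans (expect_le univ_nonempty fun p _ => ?_)
  rw [hammingDist_eq_sum, hammingDist_eq_sum, ← sum_sub_distrib, Finset.card_filter]
  push_cast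
  refine (abs_sum_le_sum_abs _ _).trans (sum_le_sum fun j _ => ?_)
  split_ifs with h1 h2 h3 h4 <;> try simp
  all_goals
    exfalso
    have h : ∀ k, f (sharedSeed (t + 1) p k) j = f (sharedSeed t p k) j := fun k => by
      refine hA _ _ _ fun i hi => ?_
      have : i.val ≠ t.val := fun h => by
        have := Fin.ext h
        subst this
        contradiction
      have h' : i.val < t.val + 1 ↔ i.val < t.val := by omega
      simp only [sharedSeed, h']
    simp_all

/-- If the function `f` of independent seeds depends locally on them and is symmetric under
complementation, it rarely takes values in a set without triples of points at pairwise distances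
between `a n` and `b n`. -/
theorem cube_expect_mem_le [Nonempty Ω] {n : ℕ} (hn : 0 < n) (f : (Fin n → Ω) → Fin n → Bool)
    (A : Fin n → Finset (Fin n)) (hA : ∀ j u v, (∀ i ∈ A j, u i = v i) → f u j = f v j)
    (e : Equiv.Perm Ω) (he : ∀ u j, f (fun i => e (u i)) j = !f u j) {a b s δ : ℝ} (ha : 0 ≤ a) (hs : 0 < s)
    (hδ : 0 < δ) (hab : a + 2 * δ + s ≤ b) (hb : b ≤ 1 / 2)
    (hQ : (#{jk : Fin n × Fin n | ¬ Disjoint (A jk.1) (A jk.2)} : ℝ) ≤ s ^ 2 * n ^ 2)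
    (S : Finset (Fin n → Bool))
    (hS : ∀ σ : Fin 3 → Fin n → Bool, (∀ k, σ k ∈ S) →
      ¬ ∀ k l, k ≠ l → a * n ≤ hammingDist (σ k) (σ l) ∧ (hammingDist (σ k) (σ l) : ℝ) ≤ b * n) :
    (𝔼 u, if f u ∈ S then (1 : ℝ) else 0) ^ 3 ≤ 9 * (s / δ) ^ 2 := by
  have hn' : (0 : ℝ) < n := by exact_mod_cast hn
  have h01 : (0 : Fin 3) ≠ 1 := by decide
  set D : ℕ → ℝ := fun t => meanDist f t (0 : Fin 3) 1 with hD
  have hDkl : ∀ t (k l : Fin 3), k ≠ l → meanDist f t k l = D t := by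
    intro t k l hkl
    have : ∀ k l : Fin 3, k ≠ l → ∃ π : Equiv.Perm (Fin 3), π 0 = k ∧ π 1 = l := by decide
    obtain ⟨π, rfl, rfl⟩ := this k l hkl
    exact meanDist_perm f t 0 1 π
  have hD0 : D 0 = n / 2 := meanDist_zero f e he h01
  have hDn : D n = 0 := meanDist_all f 0 1
  have hstep : ∀ t < n, D t ≤ D (t + 1) + s * n := by
    intro t ht
    have h1 := abs_meanDist_succ_sub_le f A hA ⟨t, ht⟩ (0 : Fin 3) 1
    have h2 : ((#{j | (⟨t, ht⟩ : Fin n) ∈ A j} : ℕ) : ℝ) ≤ s * n := by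
      refine (sq_le_sq₀ (by positivity) (by positivity)).1 ?_
      rw [mul_pow]
      refine le_trans ?_ hQ
      -- Any two coordinates that depend on the seed `t` form a pair with intersecting supports, so
      -- the square of their number is bounded by `hQ`.
      rw [sq, ← Nat.cast_mul, ← card_product]
      refine Nat.cast_le.2 (card_le_card fun jk hjk => ?_)
      simp only [mem_product, mem_filter, mem_univ, true_and] at hjk ⊢
      exact Finset.not_disjoint_iff.2 ⟨_, hjk.1, hjk.2⟩
    have h3 := (abs_le.1 h1).1
    simp only [hD]
    simp only at h3
    linarith
  have hex : ∃ t, D t < (b - δ) * n := ⟨n, by rw [hDn]; exact mul_pos (by linarith) hn'⟩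
  classical
  -- At the first time below `(b - δ) n` the mean distance has dropped by at most `s n`, so it is
  -- still at least `(a + δ) n`; this uses `a + 2δ + s ≤ b`.
  set t := Nat.find hex with ht
  have ht1 : D t < (b - δ) * n := Nat.find_spec hex
  have ht0 : t ≠ 0 := by
    intro h
    rw [h, hD0] at ht1
    nlinarith
  have htn : t ≤ n := Nat.find_min' hex (by rw [hDn]; exact mul_pos (by linarith) hn')
  have ht2 : (a + δ) * n ≤ D t := by
    have h1 : ¬ D (t - 1) < (b - δ) * n := Nat.find_min hex (by omega)
    have h2 := hstep (t - 1) (by omega)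
    rw [Nat.sub_add_cancel (by omega)] at h2
    nlinarith
  set dist : Fin 3 → Fin 3 → Seeds (Fin n) Ω (Fin 3) → ℝ := fun k l p =>
    (hammingDist (f (sharedSeed t p k)) (f (sharedSeed t p l)) : ℝ) with hdist
  have hcheb : ∀ k l, 𝔼 p, (if δ * n ≤ |dist k l p - 𝔼 q, dist k l q| then (1 : ℝ) else 0) ≤
      (s / δ) ^ 2 := by
    intro k l
    have hvar := variance_sum_le A (fun j (p : Seeds (Fin n) Ω (Fin 3)) =>
      if f (sharedSeed t p k) j ≠ f (sharedSeed t p l) j then (1 : ℝ) else 0)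
      (fun j p => by split_ifs <;> simp) (fun j p q hpq => by
        have h : ∀ k, f (sharedSeed t p k) j = f (sharedSeed t q k) j := fun k => by
          refine hA _ _ _ fun i hi => ?_
          simp only [sharedSeed, (hpq i hi).1, (hpq i hi).2]
        simp only [h])
    simp only [← hammingDist_eq_sum] at hvar
    refine (chebyshev_expect _ (mul_pos hδ hn') (hvar.trans hQ)).trans (le_of_eq ?_)
    field_simp
  refine (cube_expect_le t _ fun u => by split_ifs <;> simp).trans ?_
  -- If all outputs lie in `S`, some pair has its distance outside the window, hence at least `δ n`
  -- from its mean. The union bound over `Fin 3 × Fin 3` produces the factor 9.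
  have hpt : ∀ p : Seeds (Fin n) Ω (Fin 3),
      (∏ k, if f (sharedSeed t p k) ∈ S then (1 : ℝ) else 0) ≤
        ∑ kl : Fin 3 × Fin 3,
          if δ * n ≤ |dist kl.1 kl.2 p - 𝔼 q, dist kl.1 kl.2 q| then (1 : ℝ) else 0 := by
    intro p
    have hnn : ∀ kl ∈ (univ : Finset (Fin 3 × Fin 3)),
        (0 : ℝ) ≤ if δ * n ≤ |dist kl.1 kl.2 p - 𝔼 q, dist kl.1 kl.2 q| then (1 : ℝ) else 0 :=
      fun _ _ => by split_ifs <;> simp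
    by_cases hmem : ∀ k, f (sharedSeed t p k) ∈ S
    · have h1 := hS (fun k => f (sharedSeed t p k)) hmem
      push Not at h1
      obtain ⟨k, l, hkl, h1⟩ := h1
      simp only [hmem, if_true, prod_const_one]
      refine le_trans (le_of_eq ?_) (single_le_sum hnn (mem_univ (k, l)))
      rw [if_pos]
      have hE : (𝔼 q, dist k l q) = D t := hDkl t k l hkl
      simp only [hE]
      by_contra hlt
      push Not at hlt
      rw [abs_lt] at hlt
      have h2 : (dist k l p) ≤ b * n := by nlinarith
      have h3 : a * n ≤ dist k l p := by nlinarith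
      exact absurd h2 (not_le.2 (h1 h3))
    · push Not at hmem
      obtain ⟨k, hk⟩ := hmem
      rw [prod_eq_zero (mem_univ k) (by simp [hk])]
      exact sum_nonneg hnn
  refine (expect_le_expect fun p _ => hpt p).trans ?_
  rw [expect_sum_comm]
  refine (sum_le_sum fun kl _ => hcheb kl.1 kl.2).trans (le_of_eq ?_)
  simp

end Coupling

/-! ### Neighborhoods and their behavior under reduction -/

namespace Inst

variable {V C : Type}

theorem edist_le_succ_cases {α : Type} {G : SimpleGraph α} {x a : α} {k : ℕ}
    (h : G.edist x a ≤ (k + 1 : ℕ)) : a = x ∨ ∃ a', G.Adj a' a ∧ G.edist x a' ≤ k := by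
  rw [SimpleGraph.edist_comm] at h
  obtain ⟨p, hp⟩ := SimpleGraph.exists_walk_of_edist_ne_top
    (ne_top_of_le_ne_top (ENat.natCast_ne_top _) h)
  rw [← hp] at h
  cases p with
  | nil => exact Or.inl rfl
  | cons hadj q =>
    refine Or.inr ⟨_, hadj.symm, ?_⟩
    rw [SimpleGraph.edist_comm]
    refine (SimpleGraph.edist_le q).trans ?_
    rw [SimpleGraph.Walk.length_cons] at h
    have h' : q.length + 1 ≤ k + 1 := by exact_mod_cast h
    exact_mod_cast (by omega : q.length ≤ k)

/-- A shortest path from `x` stays in the ball, so each of its edges belongs to a clause on which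
the instances agree. -/
theorem edist_le_of_agree {Φ Ψ : Inst V C} {x : V} {r : ℕ}
    (h : ∀ c, Φ.factorGraph.edist (Sum.inl x) (Sum.inr c) ≤ r → ∀ v, Φ.lit c v = Ψ.lit c v)
    {k : ℕ} (hk : k ≤ r) {a : V ⊕ C} (ha : Φ.factorGraph.edist (Sum.inl x) a ≤ k) :
    Ψ.factorGraph.edist (Sum.inl x) a ≤ k := by
  induction k generalizing a with
  | zero =>
    rw [Nat.cast_zero, nonpos_iff_eq_zero, SimpleGraph.edist_eq_zero_iff] at ha
    subst ha
    simp
  | succ k ih =>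
    rcases edist_le_succ_cases ha with rfl | ⟨a', hadj, ha'⟩
    · simp
    · have h1 := ih (by omega) ha'
      have hlek : (k : ℕ∞) ≤ r := by exact_mod_cast (by omega : k ≤ r)
      have hlek' : ((k + 1 : ℕ) : ℕ∞) ≤ r := by exact_mod_cast hk
      have h2 : Ψ.factorGraph.Adj a' a := by
        rw [factorGraph, SimpleGraph.fromRel_adj] at hadj
        obtain ⟨-, ⟨v, c, rfl, rfl, ho⟩ | ⟨v, c, rfl, rfl, ho⟩⟩ := hadj
        · refine factorGraph_adj_of_occurs _ ?_
          rwa [Occurs, ← h c (ha.trans hlek')]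
        · refine (factorGraph_adj_of_occurs _ ?_).symm
          rwa [Occurs, ← h c (ha'.trans hlek)]
      refine (edist_succ_of_adj _ h2).trans ?_
      push_cast
      gcongr

theorem rootedIso_ball_of_agree {Φ Ψ : Inst V C} {x : V} {r : ℕ}
    (h : ∀ c, Φ.factorGraph.edist (Sum.inl x) (Sum.inr c) ≤ r ∨
      Ψ.factorGraph.edist (Sum.inl x) (Sum.inr c) ≤ r →
        (∀ v, Φ.lit c v = Ψ.lit c v) ∧ Φ.sign c = Ψ.sign c) :
    (Φ.ball x r).RootedIso (Φ.ballRoot x r) (Ψ.ball x r) (Ψ.ballRoot x r) := by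
  have key : ∀ a, Φ.factorGraph.edist (Sum.inl x) a ≤ r ↔
      Ψ.factorGraph.edist (Sum.inl x) a ≤ r := fun a =>
    ⟨edist_le_of_agree (fun c hc => (h c (Or.inl hc)).1) le_rfl,
      edist_le_of_agree (fun c hc v => ((h c (Or.inr hc)).1 v).symm) le_rfl⟩
  refine ⟨Equiv.subtypeEquivRight fun v => key _, Equiv.subtypeEquivRight fun c => key _, rfl,
    fun c v => ?_, fun c => ?_⟩
  · exact ((h c.1 (Or.inl c.2)).1 v.1).symm
  · exact (h c.1 (Or.inl c.2)).2.symm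

/-- The variables that are in `S` or share a clause with a variable of `S`. -/
def expand (Φ : Inst V C) (S : Set V) : Set V :=
  {v | ∃ u ∈ S, v = u ∨ ∃ c, Φ.Occurs c u ∧ Φ.Occurs c v}

theorem expand_mono (Φ : Inst V C) {S T : Set V} (h : S ⊆ T) : Φ.expand S ⊆ Φ.expand T :=
  fun _ ⟨u, hu, hv⟩ => ⟨u, h hu, hv⟩

theorem subset_expand (Φ : Inst V C) (S : Set V) : S ⊆ Φ.expand S :=
  fun v hv => ⟨v, hv, Or.inl rfl⟩

/-- The variables reached from `S` in at most `R` steps between variables sharing a clause. -/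
def reach (Φ : Inst V C) (R : ℕ) (S : Set V) : Set V := Φ.expand^[R] S

theorem reach_succ (Φ : Inst V C) (R : ℕ) (S : Set V) :
    Φ.reach (R + 1) S = Φ.reach R (Φ.expand S) := Function.iterate_succ_apply _ _ _

theorem reach_succ' (Φ : Inst V C) (R : ℕ) (S : Set V) :
    Φ.reach (R + 1) S = Φ.expand (Φ.reach R S) := Function.iterate_succ_apply' _ _ _

theorem reach_mono (Φ : Inst V C) (R : ℕ) {S T : Set V} (h : S ⊆ T) :
    Φ.reach R S ⊆ Φ.reach R T := by
  induction R generalizing S T with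
  | zero => exact h
  | succ R ih => rw [reach_succ, reach_succ]; exact ih (Φ.expand_mono h)

theorem reach_add (Φ : Inst V C) (Q R : ℕ) (S : Set V) :
    Φ.reach (Q + R) S = Φ.reach Q (Φ.reach R S) := Function.iterate_add_apply _ _ _ _

theorem reach_le (Φ : Inst V C) {Q R : ℕ} (h : Q ≤ R) (S : Set V) :
    Φ.reach Q S ⊆ Φ.reach R S := by
  induction h with
  | refl => exact le_rfl
  | step _ ih => rw [reach_succ']; exact ih.trans (Φ.subset_expand _)

theorem mem_reach_comm (Φ : Inst V C) {R : ℕ} {u v : V} :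
    v ∈ Φ.reach R {u} → u ∈ Φ.reach R {v} := by
  induction R generalizing v with
  | zero => exact fun h => (Set.mem_singleton_iff.1 h).symm
  | succ R ih =>
    intro h
    rw [reach_succ'] at h
    obtain ⟨w, hw, hv⟩ := h
    rw [reach_succ]
    refine Φ.reach_mono R ?_ (ih hw)
    rw [Set.singleton_subset_iff]
    refine ⟨v, rfl, hv.imp Eq.symm ?_⟩
    exact fun ⟨c, h1, h2⟩ => ⟨c, h2, h1⟩

theorem mem_reach_trans (Φ : Inst V C) {Q R : ℕ} {u v w : V} (h1 : v ∈ Φ.reach Q {u})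
    (h2 : w ∈ Φ.reach R {v}) : w ∈ Φ.reach (Q + R) {u} := by
  rw [add_comm, reach_add]
  exact Φ.reach_mono R (Set.singleton_subset_iff.2 h1) h2

/-- One step between variables sharing a clause is two edges of the factor graph, and clauses sit at
odd distances; hence the two roundings. -/
theorem mem_reach_of_edist_le (Φ : Inst V C) (x : V) (k : ℕ) :
    (∀ v, Φ.factorGraph.edist (Sum.inl x) (Sum.inl v) ≤ k → v ∈ Φ.reach (k / 2) {x}) ∧
    (∀ c, Φ.factorGraph.edist (Sum.inl x) (Sum.inr c) ≤ k →
      1 ≤ k ∧ ∃ v ∈ Φ.reach ((k - 1) / 2) {x}, Φ.Occurs c v) := by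
  induction k with
  | zero =>
    constructor
    · intro v hv
      rw [Nat.cast_zero, nonpos_iff_eq_zero, SimpleGraph.edist_eq_zero_iff] at hv
      exact (Sum.inl_injective hv).symm
    · intro c hc
      rw [Nat.cast_zero, nonpos_iff_eq_zero, SimpleGraph.edist_eq_zero_iff] at hc
      exact absurd hc (by simp)
  | succ k ih =>
    constructor
    · intro v hv
      rcases edist_le_succ_cases hv with h | ⟨a', hadj, ha'⟩
      · rw [Sum.inl_injective h]
        exact Φ.reach_le (Nat.zero_le _) {x} rfl
      · rw [factorGraph, SimpleGraph.fromRel_adj] at hadj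
        obtain ⟨-, ⟨w, c, -, h2, -⟩ | ⟨w, c, h1, rfl, ho⟩⟩ := hadj
        · exact absurd h2 (by simp)
        · obtain ⟨hk, w', hw', how⟩ := ih.2 c ha'
          have : (k + 1) / 2 = (k - 1) / 2 + 1 := by omega
          rw [this, reach_succ']
          rw [Sum.inl_injective h1]
          exact ⟨w', hw', Or.inr ⟨c, how, ho⟩⟩
    · intro c hc
      refine ⟨by omega, ?_⟩
      rcases edist_le_succ_cases hc with h | ⟨a', hadj, ha'⟩
      · exact absurd h (by simp)
      · rw [factorGraph, SimpleGraph.fromRel_adj] at hadj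
        obtain ⟨-, ⟨w, c', rfl, h2, ho⟩ | ⟨w, c', h1, -, -⟩⟩ := hadj
        · rw [Sum.inr_injective h2]
          exact ⟨w, ih.1 w ha', ho⟩
        · exact absurd h1 (by simp)

/-- The instance that remains when the variables of a list have received their values. -/
noncomputable def reduce (Φ : Inst V C) (xs : List V) (σ : V → Bool) : Inst V C :=
  xs.foldl (fun Ψ x => Ψ.assign x (σ x)) Φ

theorem reduce_cons (Φ : Inst V C) (x : V) (xs : List V) (σ : V → Bool) :
    Φ.reduce (x :: xs) σ = (Φ.assign x (σ x)).reduce xs σ := rfl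

theorem occurs_of_assign {Φ : Inst V C} {x : V} {b : Bool} {c : C} {v : V}
    (h : (Φ.assign x b).Occurs c v) : Φ.Occurs c v := by
  unfold Occurs assign at h
  simp only at h
  split_ifs at h
  · simp at h
  · exact h

theorem occurs_of_reduce {Φ : Inst V C} {xs : List V} {σ : V → Bool} {c : C} {v : V}
    (h : (Φ.reduce xs σ).Occurs c v) : Φ.Occurs c v := by
  induction xs generalizing Φ with
  | nil => exact h
  | cons x xs ih => exact occurs_of_assign (ih h)

theorem assign_clause_congr {Φ Ψ : Inst V C} {c : C} (hl : ∀ v, Φ.lit c v = Ψ.lit c v)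
    (hs : Φ.sign c = Ψ.sign c) {x : V} {b b' : Bool} (hb : Φ.Occurs c x → b = b') :
    (∀ v, (Φ.assign x b).lit c v = (Ψ.assign x b').lit c v) ∧
      (Φ.assign x b).sign c = (Ψ.assign x b').sign c := by
  classical
  by_cases ho : Φ.Occurs c x
  · obtain rfl := hb ho
    constructor
    · intro v
      simp only [assign, SatisfiedBy, hl, hs]
      congr
    · simp only [assign, hl, hs]
  · have h1 : Φ.lit c x = none := by simpa [Occurs] using ho
    have h2 : Ψ.lit c x = none := by rw [← hl, h1]
    constructor
    · intro v
      simp only [assign, SatisfiedBy, h1, h2, hl]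
      simp
    · simp only [assign, h1, h2, hs]

theorem reduce_clause_congr {Φ Ψ : Inst V C} {c : C} (hl : ∀ v, Φ.lit c v = Ψ.lit c v)
    (hs : Φ.sign c = Ψ.sign c) {xs : List V} {σ σ' : V → Bool}
    (h : ∀ x ∈ xs, Φ.Occurs c x → σ x = σ' x) :
    (∀ v, (Φ.reduce xs σ).lit c v = (Ψ.reduce xs σ').lit c v) ∧
      (Φ.reduce xs σ).sign c = (Ψ.reduce xs σ').sign c := by
  induction xs generalizing Φ Ψ with
  | nil => exact ⟨hl, hs⟩
  | cons x xs ih =>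
    obtain ⟨h1, h2⟩ := assign_clause_congr hl hs (h x (by simp))
    exact ih h1 h2 fun y hy ho => h y (by simp [hy]) (occurs_of_assign ho)

theorem factorGraph_mono {Φ Ψ : Inst V C} (h : ∀ c v, Ψ.Occurs c v → Φ.Occurs c v) :
    Ψ.factorGraph ≤ Φ.factorGraph := by
  intro a b hab
  rw [factorGraph, SimpleGraph.fromRel_adj] at hab ⊢
  refine ⟨hab.1, hab.2.imp ?_ ?_⟩ <;>
    exact fun ⟨v, c, h1, h2, h3⟩ => ⟨v, c, h1, h2, h _ _ h3⟩

/-- Reduction only deletes occurrences, so distances can only grow. A clause of the reduced ball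
has, in the original instance, a variable within `ρ - 1` steps of `x`; all its original variables,
also those already assigned, are then within `ρ` steps. -/
theorem rootedIso_ball_reduce {Φ : Inst V C} {xs : List V} {σ σ' : V → Bool} {x : V} {ρ : ℕ}
    (h : ∀ y ∈ xs, y ∈ Φ.reach ρ {x} → σ y = σ' y) :
    ((Φ.reduce xs σ).ball x (2 * ρ)).RootedIso ((Φ.reduce xs σ).ballRoot x (2 * ρ))
      ((Φ.reduce xs σ').ball x (2 * ρ)) ((Φ.reduce xs σ').ballRoot x (2 * ρ)) := by
  refine rootedIso_ball_of_agree fun c hc => ?_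
  have hc' : Φ.factorGraph.edist (Sum.inl x) (Sum.inr c) ≤ (2 * ρ : ℕ) := by
    rcases hc with hc | hc
    all_goals
      exact (SimpleGraph.edist_anti (factorGraph_mono fun _ _ => occurs_of_reduce)).trans hc
  obtain ⟨hρ, v, hv, ho⟩ := (Φ.mem_reach_of_edist_le x (2 * ρ)).2 c hc'
  refine reduce_clause_congr (fun _ => rfl) rfl fun y hy hoy => h y hy ?_
  have h1 : ρ = (2 * ρ - 1) / 2 + 1 := by omega
  rw [h1, reach_succ']
  exact ⟨v, hv, Or.inr ⟨c, ho, hoy⟩⟩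

theorem assign_compl (Φ : Inst V C) (x : V) (b : Bool) :
    Φ.compl.assign x (!b) = (Φ.assign x b).compl := by
  classical
  have h : ∀ c, Φ.compl.SatisfiedBy x (!b) c ↔ Φ.SatisfiedBy x b c := by
    intro c
    refine exists_congr fun p => and_congr_right fun _ => ?_
    have h1 : Φ.compl.sign c = -Φ.sign c := rfl
    rw [h1, litVal_not]
    generalize Φ.sign c = s
    cases s <;> simp
  simp only [assign, h]
  simp only [compl]
  congr 1
  funext c
  cases hc : Φ.lit c x with
  | none => rfl
  | some p =>
    simp only [litVal_not]
    generalize Φ.sign c = s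
    cases s <;> cases litVal p b <;> rfl

end Inst

/-! ### Decimation as a deterministic function of seeds -/

section Run

open Finset BigOperators

variable {V C : Type} [DecidableEq V] {N : ℕ}

/-- Decimation with deterministic seeds: the current variable `x` is set to `1` iff its seed is
less than the threshold `k Φ x` of the current instance. -/
noncomputable def run (k : Inst V C → V → ℕ) (u : V → Fin N) :
    List V → Inst V C → (V → Bool) → V → Bool
  | [], _, σ => σ
  | x :: xs, Φ, σ => run k u xs (Φ.assign x (decide ((u x).val < k Φ x)))
      (Function.update σ x (decide ((u x).val < k Φ x)))

variable (k : Inst V C → V → ℕ)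

theorem run_of_notMem (u : V → Fin N) {xs : List V} (Φ : Inst V C) (σ : V → Bool) {x : V}
    (hx : x ∉ xs) : run k u xs Φ σ x = σ x := by
  induction xs generalizing Φ σ with
  | nil => rfl
  | cons y xs ih =>
    rw [List.mem_cons, not_or] at hx
    rw [run, ih _ _ hx.2, Function.update_of_ne hx.1]

theorem run_congr {u v : V → Fin N} {xs : List V} (h : ∀ x ∈ xs, u x = v x) (Φ : Inst V C)
    (σ : V → Bool) : run k u xs Φ σ = run k v xs Φ σ := by
  induction xs generalizing Φ σ with
  | nil => rfl
  | cons y xs ih =>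
    rw [run, run, h y (by simp), ih fun x hx => h x (by simp [hx])]

/-- Assigned values are never overwritten, so the instance met at `x` can be read off the final
output. This turns the run into a recursion on its own output. -/
theorem run_spec (u : V → Fin N) (pre : List V) (x : V) (post : List V)
    (hnd : (pre ++ x :: post).Nodup) (Φ : Inst V C) (σ : V → Bool) :
    run k u (pre ++ x :: post) Φ σ x =
      decide ((u x).val < k (Φ.reduce pre (run k u (pre ++ x :: post) Φ σ)) x) := by
  induction pre generalizing Φ σ with
  | nil =>
    rw [List.nil_append, List.nodup_cons] at hnd
    rw [List.nil_append, run, run_of_notMem k u _ _ hnd.1, Function.update_self]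
    rfl
  | cons y pre ih =>
    rw [List.cons_append, List.nodup_cons] at hnd
    rw [List.cons_append, Inst.reduce_cons, run, ih hnd.2, run_of_notMem k u _ _ hnd.1,
      Function.update_self]

theorem run_compl (hk : ∀ Φ x, k Φ x ≤ N ∧ k (Inst.compl Φ) x = N - k Φ x) (u : V → Fin N)
    (xs : List V) (Φ : Inst V C) (σ σ' : V → Bool) {x : V} (h : x ∈ xs ∨ σ' x = !σ x) :
    run k (fun i => (u i).rev) xs Φ.compl σ' x = !run k u xs Φ σ x := by
  induction xs generalizing Φ σ σ' with
  | nil => simpa [run] using h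
  | cons y xs ih =>
    -- A seed is below `k` iff its reversal is not below `N - k`.
    have hb : decide (((u y).rev).val < k Φ.compl y) = !decide ((u y).val < k Φ y) := by
      have h1 := hk Φ y
      have h2 := (u y).isLt
      rw [h1.2, ← decide_not, decide_eq_decide, Fin.val_rev]
      omega
    rw [run, run, hb, Inst.assign_compl]
    refine ih _ _ _ ?_
    by_cases hxy : x = y
    · subst hxy
      simp
    · rw [Function.update_of_ne hxy, Function.update_of_ne hxy]
      rcases h with h | h
      · rw [List.mem_cons] at h
        exact Or.inl (h.resolve_left hxy)
      · exact Or.inr h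

theorem expect_update [Fintype V] {Ω : Type} [Fintype Ω] [Nonempty Ω] (x : V)
    (G : (V → Ω) → ℝ) : 𝔼 u, G u = 𝔼 u, 𝔼 s, G (Function.update u x s) := by
  have e : (𝔼 p : (V → Ω) × Ω, G (Function.update p.1 x p.2)) =
      𝔼 p : (V → Ω) × Ω, G p.1 := by
    refine Fintype.expect_equiv
      ⟨fun p => (Function.update p.1 x p.2, p.1 x), fun p => (Function.update p.1 x p.2, p.1 x),
        fun p => ?_, fun p => ?_⟩ _ _ fun p => rfl
    all_goals simp
  rw [expect_prod, expect_prod] at e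
  simp only [expect_const univ_nonempty] at e
  exact e.symm

theorem coin_apply (p : unitInterval) (b : Bool) :
    coin p b = if b = true then ENNReal.ofReal (p : ℝ) else ENNReal.ofReal (1 - (p : ℝ)) := rfl

theorem expect_threshold [NeZero N] {j : ℕ} (hj : j ≤ N) (a b : ℝ) :
    (𝔼 s : Fin N, if s.val < j then a else b) = j / N * a + (1 - j / N) * b := by
  have hN : (N : ℝ) ≠ 0 := by exact_mod_cast NeZero.ne N
  have h1 : ∀ s : Fin N, (if s.val < j then a else b) =
      (if s.val < j then 1 else 0) * (a - b) + b := by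
    intro s
    split_ifs <;> ring
  have h2 : (∑ s : Fin N, if s.val < j then (1 : ℝ) else 0) = j := by
    rw [Fin.sum_univ_eq_sum_range (fun i => if i < j then (1 : ℝ) else 0), ← sum_filter]
    have : (range N).filter (· < j) = range j := by
      ext i
      simp only [mem_filter, mem_range]
      omega
    rw [this]
    simp
  simp only [h1]
  rw [expect_add_distrib, expect_const univ_nonempty, ← expect_mul,
    Fintype.expect_eq_sum_div_card, h2, Fintype.card_fin]
  field_simp
  ring

/-- A uniform seed in `Fin N` is below `j` with probability `j / N`. Later variables do not use the
seed of `x`, so it can be averaged separately. -/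
theorem decimate_toOuterMeasure [Fintype V] [Fintype C] [NeZero N] {τ : Rule}
    (hk : ∀ Φ x, k Φ x ≤ N ∧ (τ V C Φ x : ℝ) = k Φ x / N) (S : Finset (V → Bool))
    {xs : List V} (hxs : xs.Nodup) (Φ : Inst V C) (σ : V → Bool) :
    (decimate τ xs Φ σ).toOuterMeasure S =
      ENNReal.ofReal (𝔼 u : V → Fin N, if run k u xs Φ σ ∈ S then (1 : ℝ) else 0) := by
  classical
  induction xs generalizing Φ σ with
  | nil =>
    rw [decimate, PMF.toOuterMeasure_pure_apply]
    by_cases h : σ ∈ S <;> simp [run, h]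
  | cons x xs ih =>
    rw [List.nodup_cons] at hxs
    have hE : ∀ b, 0 ≤ 𝔼 u : V → Fin N, if run k u xs (Φ.assign x b)
        (Function.update σ x b) ∈ S then (1 : ℝ) else 0 := fun b =>
      expect_nonneg fun _ _ => by split_ifs <;> simp
    have hp := (τ V C Φ x).2
    rw [decimate, PMF.toOuterMeasure_bind_apply, tsum_bool]
    have hupd : ∀ b, @Function.update V (fun _ => Bool) (fun a b => Classical.propDecidable (a = b))
        σ x b = Function.update σ x b := fun b => by
      congr
      exact Subsingleton.elim _ _
    simp only [coin_apply, if_true, hupd, Bool.false_eq_true, if_false]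
    rw [ih hxs.2, ih hxs.2, ← ENNReal.ofReal_mul (by linarith [hp.2]), ← ENNReal.ofReal_mul hp.1,
      ← ENNReal.ofReal_add (mul_nonneg (by linarith [hp.2]) (hE _)) (mul_nonneg hp.1 (hE _))]
    congr 1
    rw [expect_update x (fun u : V → Fin N => if run k u (x :: xs) Φ σ ∈ S then (1 : ℝ) else 0),
      mul_expect, mul_expect, ← expect_add_distrib]
    refine expect_congr rfl fun u _ => ?_
    rw [(hk Φ x).2, add_comm, ← expect_threshold (hk Φ x).1]
    refine expect_congr rfl fun s _ => ?_
    have hcongr : ∀ b : Bool, run k (Function.update u x s) xs (Φ.assign x b)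
        (Function.update σ x b) = run k u xs (Φ.assign x b) (Function.update σ x b) := by
      intro b
      refine run_congr k (fun y hy => ?_) _ _
      rw [Function.update_of_ne]
      rintro rfl
      exact hxs.1 hy
    rw [run, Function.update_self, hcongr]
    by_cases h : s.val < k Φ x <;> simp [h]

end Run

/-! ### Which seeds a value depends on -/

section Influence

variable {n : ℕ} {C : Type}

/-- The value of the variable `i` may influence the one of `j` when the depth of the rule
is `2 ρ`. -/
def Influences (Φ : Inst (Fin n) C) (ρ : ℕ) : Fin n → Fin n → Prop :=
  Relation.ReflTransGen fun i j => i < j ∧ j ∈ Φ.reach ρ {i}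

/-- The threshold at `j` depends only on output values of earlier variables within `ρ` steps, and by
induction each of these depends only on its own influences. -/
theorem run_eq_of_influences [Fintype C] {N ρ : ℕ} {τ : Rule} (hτ : τ.IsLocal (2 * ρ))
    {k : Inst (Fin n) C → Fin n → ℕ}
    (hk : ∀ Φ x Ψ y, τ (Fin n) C Φ x = τ (Fin n) C Ψ y → k Φ x = k Ψ y) (Φ : Inst (Fin n) C)
    (σ : Fin n → Bool) (j : Fin n) (u v : Fin n → Fin N)
    (h : ∀ i, Influences Φ ρ i j → u i = v i) :
    run k u (List.finRange n) Φ σ j = run k v (List.finRange n) Φ σ j := by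
  induction j using WellFoundedLT.induction with
  | ind j ih =>
    obtain ⟨pre, post, hl⟩ := List.append_of_mem (List.mem_finRange j)
    have hnd := List.nodup_finRange n
    have hlt := List.pairwise_lt_finRange n
    rw [hl] at hnd hlt
    rw [hl, run_spec k u pre j post hnd, run_spec k v pre j post hnd,
      h j Relation.ReflTransGen.refl, ← hl]
    congr 2
    refine hk _ _ _ _ ?_
    refine hτ _ _ _ _ _ _ _ _ (Inst.rootedIso_ball_reduce fun y hy hyj => ?_)
    have hyj' : y < j := (List.pairwise_append.1 hlt).2.2 y hy j (by simp)
    refine ih y hyj' fun i hi => h i (Relation.ReflTransGen.tail hi ⟨hyj', ?_⟩)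
    exact Φ.mem_reach_comm hyj

end Influence

/-! ### Exponential moments of neighborhoods in the random formula -/

section RandomFormula

open Finset BigOperators

variable {K n : ℕ} {ι : Type}

/-- A formula with clauses indexed by an arbitrary type, as an instance. -/
def formInst (F : ι → NAEClause K n) : Inst (Fin n) ι where
  lit c := (F c).1
  sign _ := 0

/-- The variables of a clause. -/
def NAEClause.vars (c : NAEClause K n) : Finset (Fin n) :=
  univ.filter fun v => (c.1 v).isSome = true

theorem NAEClause.card_vars (c : NAEClause K n) : #c.vars = K := c.2

theorem NAEClause.mem_vars (c : NAEClause K n) (v : Fin n) :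
    v ∈ c.vars ↔ (c.1 v).isSome = true := by
  simp [NAEClause.vars]

theorem formInst_occurs (F : ι → NAEClause K n) (c : ι) (v : Fin n) :
    (formInst F).Occurs c v ↔ v ∈ (F c).vars := by
  simp [Inst.Occurs, formInst, NAEClause.vars]

/-- Renaming of variables. -/
def NAEClause.rename (π : Equiv.Perm (Fin n)) : NAEClause K n ≃ NAEClause K n where
  toFun c := ⟨fun v => c.1 (π v), (card_equiv π fun v => by simp).trans c.2⟩
  invFun c := ⟨fun v => c.1 (π.symm v), (card_equiv π.symm fun v => by simp).trans c.2⟩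
  left_inv c := by ext; simp
  right_inv c := by ext; simp

theorem NAEClause.mem_vars_rename (π : Equiv.Perm (Fin n)) (c : NAEClause K n) (v : Fin n) :
    v ∈ (NAEClause.rename π c).vars ↔ π v ∈ c.vars := by
  rw [NAEClause.mem_vars, NAEClause.mem_vars]
  rfl

/-- By renaming, all variables lie in equally many clauses; then incidences are counted twice. -/
theorem card_clauses_mem (v : Fin n) :
    n * #{c : NAEClause K n | v ∈ c.vars} = K * Fintype.card (NAEClause K n) := by
  have h : ∀ w : Fin n, #{c : NAEClause K n | w ∈ c.vars} = #{c : NAEClause K n | v ∈ c.vars} := by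
    intro w
    refine card_equiv (NAEClause.rename (Equiv.swap v w)) fun c => ?_
    simp [NAEClause.mem_vars_rename]
  have h1 : ∑ w : Fin n, #{c : NAEClause K n | w ∈ c.vars} = ∑ c : NAEClause K n, #c.vars := by
    simp only [Finset.card_filter, NAEClause.vars]
    rw [sum_comm]
    simp
  simp only [h, NAEClause.card_vars, sum_const, card_univ, Fintype.card_fin, smul_eq_mul] at h1
  rw [h1, mul_comm]

theorem card_clauses_hit_le (hn : 0 < n) (S : Finset (Fin n)) :
    (#{c : NAEClause K n | ∃ v ∈ S, v ∈ c.vars} : ℝ) ≤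
      Fintype.card (NAEClause K n) * (K * #S / n) := by
  have hn' : (0 : ℝ) < n := by exact_mod_cast hn
  have h1 : #{c : NAEClause K n | ∃ v ∈ S, v ∈ c.vars} ≤
      ∑ v ∈ S, #{c : NAEClause K n | v ∈ c.vars} := by
    refine le_trans (card_le_card fun c hc => ?_) card_biUnion_le
    simpa using hc
  have h2 : n * ∑ v ∈ S, #{c : NAEClause K n | v ∈ c.vars} =
      #S * (K * Fintype.card (NAEClause K n)) := by
    rw [mul_sum]
    simp only [card_clauses_mem, sum_const, smul_eq_mul]
  have h3 : n * #{c : NAEClause K n | ∃ v ∈ S, v ∈ c.vars} ≤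
      #S * (K * Fintype.card (NAEClause K n)) := h2 ▸ Nat.mul_le_mul_left n h1
  have h4 : (n : ℝ) * #{c : NAEClause K n | ∃ v ∈ S, v ∈ c.vars} ≤
      #S * (K * Fintype.card (NAEClause K n)) := by exact_mod_cast h3
  rw [← mul_div_assoc, le_div_iff₀ hn']
  linarith

/-- The bound on the logarithm of the exponential moment of the `R`-neighborhood of a vertex. -/
noncomputable def growthRate (d : ℝ) (K : ℕ) (θ : ℝ) : ℕ → ℝ
  | 0 => θ
  | R + 1 => growthRate d K θ R + d * K * Real.exp (K * growthRate d K θ R)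

theorem growthRate_nonneg {d : ℝ} (hd : 0 ≤ d) (K : ℕ) {θ : ℝ} (hθ : 0 ≤ θ) (R : ℕ) :
    0 ≤ growthRate d K θ R := by
  induction R with
  | zero => exact hθ
  | succ R ih => rw [growthRate]; positivity

/-- The deleted clauses have all their variables in `X` already, so they add nothing to an
exploration started from `X`. -/
theorem reach_subset_of_expand_subset {Φ : Inst (Fin n) ι} {p : ι → Prop} {S X : Set (Fin n)}
    (hSX : Φ.expand S ⊆ X) (hp : ∀ c, p c ↔ ∃ v ∈ S, Φ.Occurs c v) (Ψ : Inst (Fin n) {c // ¬p c})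
    (hΨ : ∀ c v, Ψ.Occurs c v ↔ Φ.Occurs c.1 v) (R : ℕ) : Φ.reach R X ⊆ Ψ.reach R X := by
  induction R with
  | zero => exact le_rfl
  | succ R ih =>
    have hX : X ⊆ Ψ.reach R X := Ψ.reach_le (Nat.zero_le R) X
    rw [Inst.reach_succ', Inst.reach_succ']
    rintro v ⟨u, hu, rfl | ⟨c, hcu, hcv⟩⟩
    · exact ⟨v, ih hu, Or.inl rfl⟩
    · by_cases hc : p c
      · obtain ⟨w, hw, how⟩ := (hp c).1 hc
        exact Ψ.subset_expand _ (hX (hSX ⟨w, hw, Or.inr ⟨c, how, hcv⟩⟩))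
      · exact ⟨u, ih hu, Or.inr ⟨⟨c, hc⟩, (hΨ _ _).2 hcu, (hΨ _ _).2 hcv⟩⟩

/-- One layer is explored at a time. If `T` is the set of clauses meeting `S`, these bring in at
most `K * #T` variables, and the exploration continues in the formula of the other clauses. That
those avoid `S` is dropped, which only increases the sum. Summation over `T` is the binomial
theorem, and `1 + x ≤ exp x` gives the recursion of `growthRate`. The clause index type varies in
the induction, hence only an upper bound on its cardinality is assumed. -/
theorem sum_exp_reach_le [Fintype ι] [DecidableEq ι] {d θ : ℝ} (hd : 0 ≤ d) (hθ : 0 ≤ θ)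
    (hn : 0 < n) (R : ℕ) (hm : (Fintype.card ι : ℝ) ≤ d * n) (S : Finset (Fin n)) :
    ∑ F : ι → NAEClause K n, Real.exp (θ * ((formInst F).reach R S).ncard) ≤
      (Fintype.card (NAEClause K n) : ℝ) ^ Fintype.card ι *
        Real.exp (growthRate d K θ R * #S) := by
  classical
  have hn' : (0 : ℝ) < n := by exact_mod_cast hn
  induction R generalizing ι S with
  | zero =>
    refine le_of_eq ?_
    simp [Inst.reach, growthRate, Set.ncard_coe_finset]
  | succ R ih =>
    set g := growthRate d K θ R with hg
    have hg0 : 0 ≤ g := growthRate_nonneg hd K hθ R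
    set N : ℝ := ((Fintype.card (NAEClause K n) : ℕ) : ℝ) with hN
    set h : ℝ := ((#{c : NAEClause K n | ∃ v ∈ S, v ∈ c.vars} : ℕ) : ℝ) with hh
    have hfib : ∀ T : Finset ι,
        ∑ F : ι → NAEClause K n with univ.filter (fun c => ∃ v ∈ S, v ∈ (F c).vars) = T,
          Real.exp (θ * ((formInst F).reach (R + 1) S).ncard) ≤
        Real.exp (g * #S) * ((h * Real.exp (K * g)) ^ #T * N ^ (Fintype.card ι - #T)) := by
      intro T
      have hterm : ∀ F : ι → NAEClause K n,
          (if univ.filter (fun c => ∃ v ∈ S, v ∈ (F c).vars) = T then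
            Real.exp (θ * ((formInst F).reach (R + 1) S).ncard) else 0) ≤
          (∏ c : {c // c ∈ T}, if ∃ v ∈ S, v ∈ (F c.1).vars then (1 : ℝ) else 0) *
            Real.exp (θ * ((formInst fun c : {c // c ∉ T} => F c.1).reach R
              ((S ∪ univ.biUnion fun c : {c // c ∈ T} => (F c.1).vars : Finset (Fin n)) :
                Set (Fin n))).ncard) := by
        intro F
        split_ifs with hT
        · have hT' : ∀ c, c ∈ T ↔ ∃ v ∈ S, v ∈ (F c).vars := fun c => by rw [← hT]; simp
          rw [prod_eq_one fun c _ => if_pos ((hT' c.1).1 c.2), one_mul]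
          refine Real.exp_le_exp.2 (mul_le_mul_of_nonneg_left ?_ hθ)
          refine Nat.cast_le.2 (Set.ncard_le_ncard ?_ (Set.toFinite _))
          rw [Inst.reach_succ]
          refine ((formInst F).reach_mono R ?_).trans (reach_subset_of_expand_subset
            (S := (S : Set (Fin n))) ?_ (fun c => ?_) _ (fun c v => ?_) R)
          · rintro v ⟨u, hu, rfl | ⟨c, hcu, hcv⟩⟩
            · simp [mem_coe.1 hu]
            · rw [formInst_occurs] at hcu hcv
              rw [coe_union]
              refine Or.inr (mem_coe.2 (mem_biUnion.2 ⟨⟨c, (hT' c).2 ⟨u, hu, hcu⟩⟩, by simp, hcv⟩))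
          · rintro v ⟨u, hu, rfl | ⟨c, hcu, hcv⟩⟩
            · simp [mem_coe.1 hu]
            · rw [formInst_occurs] at hcu hcv
              rw [coe_union]
              refine Or.inr (mem_coe.2 (mem_biUnion.2 ⟨⟨c, (hT' c).2 ⟨u, hu, hcu⟩⟩, by simp, hcv⟩))
          · rw [hT']
            simp [formInst_occurs]
          · rw [formInst_occurs, formInst_occurs]
        · exact mul_nonneg (prod_nonneg fun _ _ => by split_ifs <;> simp) (Real.exp_nonneg _)
      rw [sum_filter]
      refine (sum_le_sum fun F _ => hterm F).trans ?_
      refine (le_of_eq (Fintype.sum_equiv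
        (Equiv.piEquivPiSubtypeProd (· ∈ T) fun _ => NAEClause K n) _
        (fun p => (∏ c : {c // c ∈ T}, if ∃ v ∈ S, v ∈ (p.1 c).vars then (1 : ℝ) else 0) *
            Real.exp (θ * ((formInst p.2).reach R
              ((S ∪ univ.biUnion fun c : {c // c ∈ T} => (p.1 c).vars : Finset (Fin n)) :
                Set (Fin n))).ncard)) (fun _ => rfl))).trans ?_
      rw [Fintype.sum_prod_type]
      have hinner : ∀ F₁ : {c // c ∈ T} → NAEClause K n,
          ∑ F₂ : {c // c ∉ T} → NAEClause K n,
            (∏ c : {c // c ∈ T}, if ∃ v ∈ S, v ∈ (F₁ c).vars then (1 : ℝ) else 0) *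
            Real.exp (θ * ((formInst F₂).reach R
              ((S ∪ univ.biUnion fun c : {c // c ∈ T} => (F₁ c).vars : Finset (Fin n)) :
                Set (Fin n))).ncard) ≤
          (∏ c : {c // c ∈ T}, if ∃ v ∈ S, v ∈ (F₁ c).vars then (1 : ℝ) else 0) *
            (N ^ (Fintype.card ι - #T) * Real.exp (g * (#S + #T * K))) := by
        intro F₁
        rw [← mul_sum]
        refine mul_le_mul_of_nonneg_left ?_ (prod_nonneg fun _ _ => by split_ifs <;> simp)
        have hcard : Fintype.card {c // c ∉ T} = Fintype.card ι - #T := by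
          rw [Fintype.card_subtype_compl, Fintype.card_coe]
        refine (ih ?_ _).trans ?_
        · refine le_trans ?_ hm
          exact_mod_cast Fintype.card_subtype_le _
        · rw [hcard]
          refine mul_le_mul_of_nonneg_left (Real.exp_le_exp.2 (mul_le_mul_of_nonneg_left ?_ hg0))
            (by positivity)
          have h1 : #(S ∪ univ.biUnion fun c : {c // c ∈ T} => (F₁ c).vars) ≤ #S + #T * K := by
            refine (card_union_le _ _).trans (Nat.add_le_add_left ?_ _)
            refine (card_biUnion_le_card_mul _ _ K fun c _ => (NAEClause.card_vars _).le).trans ?_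
            simp
          exact_mod_cast h1
      refine (sum_le_sum fun F₁ _ => hinner F₁).trans (le_of_eq ?_)
      rw [← sum_mul]
      have hprod : ∑ F₁ : {c // c ∈ T} → NAEClause K n,
          (∏ c : {c // c ∈ T}, if ∃ v ∈ S, v ∈ (F₁ c).vars then (1 : ℝ) else 0) = h ^ #T := by
        have := prod_univ_sum (fun _ : {c // c ∈ T} => (univ : Finset (NAEClause K n)))
          (fun _ c => if ∃ v ∈ S, v ∈ c.vars then (1 : ℝ) else 0)
        rw [Fintype.piFinset_univ] at this
        rw [← this, prod_const, hh, card_univ, Fintype.card_coe]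
        simp
      rw [hprod, mul_add, Real.exp_add, mul_pow, ← Real.exp_nat_mul]
      have : g * (#T * K) = #T * (K * g) := by ring
      rw [this]
      ring
    rw [← sum_fiberwise (s := univ)
      (g := fun F : ι → NAEClause K n => univ.filter (fun c => ∃ v ∈ S, v ∈ (F c).vars))]
    refine (sum_le_sum fun T _ => hfib T).trans ?_
    rw [← mul_sum, Fintype.sum_pow_mul_eq_add_pow]
    have hle : h * Real.exp (K * g) + N ≤ N * Real.exp (K * #S / n * Real.exp (K * g)) := by
      have h1 := card_clauses_hit_le (K := K) hn S
      have h2 : K * #S / n * Real.exp (K * g) + 1 ≤ Real.exp (K * #S / n * Real.exp (K * g)) :=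
        Real.add_one_le_exp _
      have hN0 : 0 ≤ N := by positivity
      calc h * Real.exp (K * g) + N ≤ N * (K * #S / n) * Real.exp (K * g) + N := by gcongr
        _ = N * (K * #S / n * Real.exp (K * g) + 1) := by ring
        _ ≤ _ := mul_le_mul_of_nonneg_left h2 hN0
    calc Real.exp (g * #S) * (h * Real.exp (K * g) + N) ^ Fintype.card ι
        ≤ Real.exp (g * #S) *
          (N * Real.exp (K * #S / n * Real.exp (K * g))) ^ Fintype.card ι := by gcongr
      _ = N ^ Fintype.card ι *
          Real.exp (g * #S + Fintype.card ι * (K * #S / n * Real.exp (K * g))) := by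
        rw [mul_pow, ← Real.exp_nat_mul, Real.exp_add]
        ring
      _ ≤ _ := by
        refine mul_le_mul_of_nonneg_left (Real.exp_le_exp.2 ?_) (by positivity)
        rw [growthRate, ← hg, add_mul]
        refine add_le_add le_rfl ?_
        calc (Fintype.card ι : ℝ) * (K * #S / n * Real.exp (K * g))
            ≤ d * n * (K * #S / n * Real.exp (K * g)) := by gcongr
          _ = _ := by field_simp

theorem expect_exp_reach_le [Fintype ι] [DecidableEq ι] [Nonempty (NAEClause K n)] {d θ : ℝ}
    (hd : 0 ≤ d) (hθ : 0 ≤ θ) (hn : 0 < n) (R : ℕ) (hm : (Fintype.card ι : ℝ) ≤ d * n)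
    (v : Fin n) :
    𝔼 F : ι → NAEClause K n, Real.exp (θ * ((formInst F).reach R {v}).ncard) ≤
      Real.exp (growthRate d K θ R) := by
  have h := sum_exp_reach_le (K := K) hd hθ hn R hm {v}
  have hc : (0 : ℝ) < Fintype.card (ι → NAEClause K n) := by exact_mod_cast Fintype.card_pos
  rw [Fintype.expect_eq_sum_div_card, div_le_iff₀ hc, mul_comm]
  simpa using h

end RandomFormula

/-! ### Counting increasing chains of influence -/

section Chains

open Finset BigOperators

section Walks

variable {V : Type} [Fintype V] (r : V → V → Prop)

open Classical in
/-- The walks with `l` steps. -/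
noncomputable def walks (l : ℕ) : Finset (Fin (l + 1) → V) :=
  univ.filter fun s => ∀ j : Fin l, r (s j.castSucc) (s j.succ)

theorem mem_walks {l : ℕ} {s : Fin (l + 1) → V} :
    s ∈ walks r l ↔ ∀ j : Fin l, r (s j.castSucc) (s j.succ) := by
  simp [walks]

open Classical in
/-- The number of neighbors. -/
noncomputable def valency (v : V) : ℕ := #{w | r v w}

open Classical in
-- An end of the walk other than position `i` is removed; given its neighbor it has at most `b`
-- choices.
theorem card_walks_through_le (hr : ∀ v w, r v w → r w v) (b l : ℕ) (i : Fin (l + 1)) (v : V) :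
    #{s ∈ walks r l | s i = v ∧ ∀ j, valency r (s j) ≤ b} ≤ b ^ l := by
  induction l with
  | zero =>
    rw [pow_zero, card_le_one]
    intro s hs s' hs'
    simp only [mem_filter] at hs hs'
    funext j
    have hj : j = i := Fin.ext (by omega)
    rw [hj, hs.2.1, hs'.2.1]
  | succ l ih =>
    -- Here `f` drops one end, `p` is the dropped position, `q` the position of its neighbor in the
    -- shortened walk, and `i'` the new position of `v`.
    have key : ∀ (f : (Fin (l + 2) → V) → Fin (l + 1) → V) (p : Fin (l + 2)) (q : Fin (l + 1))
        (i' : Fin (l + 1)),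
        (∀ s ∈ walks r (l + 1), f s ∈ walks r l) → (∀ s, f s i' = s i) →
        (∀ s j, ∃ j', f s j = s j') → (∀ s s', f s = f s' → s p = s' p → s = s') →
        (∀ s ∈ walks r (l + 1), r (f s q) (s p)) →
        #{s ∈ walks r (l + 1) | s i = v ∧ ∀ j, valency r (s j) ≤ b} ≤ b ^ (l + 1) := by
      intro f p q i' h1 h2 h3 h4 h5
      rw [pow_succ']
      refine (card_le_mul_card_image (f := f) _ b fun a ha => ?_).trans
        (Nat.mul_le_mul_left b ((card_le_card fun a ha => ?_).trans (ih i')))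
      · obtain ⟨s, hs, rfl⟩ := mem_image.1 ha
        simp only [mem_filter] at hs
        obtain ⟨j', hj'⟩ := h3 s q
        have hb : #{w | r (f s q) w} ≤ b := by rw [hj']; exact hs.2.2 j'
        refine le_trans (card_le_card_of_injOn (fun s => s p) (fun s' hs' => ?_) ?_) hb
        · simp only [coe_filter, Set.mem_ofPred_eq, mem_filter] at hs'
          simp only [coe_filter, Set.mem_ofPred_eq, mem_univ, true_and]
          rw [← hs'.2]
          exact h5 s' hs'.1.1
        · intro s₁ hs₁ s₂ hs₂ he
          simp only [coe_filter, Set.mem_ofPred_eq, mem_filter] at hs₁ hs₂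
          exact h4 _ _ (hs₁.2.trans hs₂.2.symm) he
      · obtain ⟨s, hs, rfl⟩ := mem_image.1 ha
        simp only [mem_filter] at hs ⊢
        refine ⟨h1 s hs.1, (h2 s).trans hs.2.1, fun j => ?_⟩
        obtain ⟨j', hj'⟩ := h3 s j
        rw [hj']
        exact hs.2.2 j'
    induction i using Fin.cases with
    | zero =>
      refine key (fun s => fun j => s j.castSucc) (Fin.last _) (Fin.last _) 0 ?_ (fun _ => rfl)
        (fun _ j => ⟨_, rfl⟩) ?_ fun s hs => (mem_walks r).1 hs (Fin.last _)
      · intro s hs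
        rw [mem_walks] at hs ⊢
        intro j
        exact hs j.castSucc
      · intro s s' h h'
        funext j
        induction j using Fin.lastCases with
        | last => exact h'
        | cast j => exact congrFun h j
    | succ i =>
      refine key (fun s => fun j => s j.succ) 0 0 i ?_ (fun _ => rfl)
        (fun _ j => ⟨_, rfl⟩) ?_ fun s hs => hr _ _ ((mem_walks r).1 hs 0)
      · intro s hs
        rw [mem_walks] at hs ⊢
        intro j
        exact hs j.succ
      · intro s s' h h'
        funext j
        induction j using Fin.cases with
        | zero => exact h'
        | succ j => exact congrFun h j

/-- Each walk is charged to one of its vertices of largest valency. -/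
theorem card_walks_le (hr : ∀ v w, r v w → r w v) (l : ℕ) :
    #(walks r l) ≤ (l + 1) * ∑ v, valency r v ^ l := by
  classical
  have h1 : walks r l ⊆ (univ : Finset (Fin (l + 1) × V)).biUnion fun p =>
      {s ∈ walks r l | s p.1 = p.2 ∧ ∀ j, valency r (s j) ≤ valency r p.2} := by
    intro s hs
    obtain ⟨i, -, hi⟩ := exists_max_image univ (fun j => valency r (s j)) univ_nonempty
    refine mem_biUnion.2 ⟨(i, s i), mem_univ _, mem_filter.2 ⟨hs, rfl, fun j => hi j (mem_univ _)⟩⟩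
  refine (card_le_card h1).trans (card_biUnion_le.trans ?_)
  refine (sum_le_sum fun p _ => card_walks_through_le r hr (valency r p.2) l p.1 p.2).trans ?_
  rw [Fintype.sum_prod_type]
  simp

end Walks

section Symmetry

variable {K n : ℕ} {ι : Type}

theorem mem_reach_rename (π : Equiv.Perm (Fin n)) (F : ι → NAEClause K n) (R : ℕ) (u v : Fin n) :
    v ∈ (formInst fun c => NAEClause.rename π (F c)).reach R {u} ↔
      π v ∈ (formInst F).reach R {π u} := by
  induction R generalizing v with
  | zero => simp [Inst.reach]
  | succ R ih =>
    rw [Inst.reach_succ', Inst.reach_succ']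
    simp only [Inst.expand, Set.mem_ofPred_eq, formInst_occurs, NAEClause.mem_vars_rename]
    constructor
    · rintro ⟨a, ha, h⟩
      exact ⟨π a, (ih a).1 ha, h.imp (congrArg π) id⟩
    · rintro ⟨a, ha, h⟩
      refine ⟨π.symm a, (ih _).2 (by simpa using ha), h.imp (fun h => ?_) fun h => ?_⟩
      · rw [← h, Equiv.symm_apply_apply]
      · simpa using h

/-- The relation of being at distance at most `ρ`. -/
def Near (F : ι → NAEClause K n) (ρ : ℕ) (u v : Fin n) : Prop := v ∈ (formInst F).reach ρ {u}

theorem valency_near (F : ι → NAEClause K n) (ρ : ℕ) (v : Fin n) :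
    valency (Near F ρ) v = ((formInst F).reach ρ {v}).ncard := by
  classical
  rw [valency, ← Set.ncard_coe_finset]
  congr 1
  simp only [coe_filter, mem_univ, true_and]
  rfl

/-- Followed backwards from `j`, the chain of influence either supplies `l` increasing steps or
reaches `i` earlier, and then `i` is close to `j`. -/
theorem exists_walk_or_mem_reach {F : ι → NAEClause K n} {ρ : ℕ} {i j : Fin n}
    (h : Influences (formInst F) ρ i j) (l : ℕ) :
    (∃ s ∈ walks (Near F ρ) l, StrictMono s ∧ s (Fin.last l) = j) ∨
      j ∈ (formInst F).reach (l * ρ) {i} := by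
  induction l generalizing j with
  | zero =>
    refine Or.inl ⟨fun _ => j, ?_, ?_, rfl⟩
    · rw [mem_walks]
      exact fun k => k.elim0
    · intro a b hab
      exact absurd hab (by omega)
  | succ l ih =>
    rcases h.cases_tail with rfl | ⟨b, hb, hbj, hnear⟩
    · exact Or.inr ((formInst F).reach_le (Nat.zero_le _) _ rfl)
    · rcases ih hb with ⟨s, hs, hmono, hlast⟩ | hreach
      · refine Or.inl ⟨Fin.snoc (α := fun _ => Fin n) s j, ?_, ?_, by simp⟩
        · rw [mem_walks] at hs ⊢
          intro k
          induction k using Fin.lastCases with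
          | last =>
            rw [Fin.snoc_castSucc, hlast, Fin.succ_last, Fin.snoc_last]
            exact hnear
          | cast k =>
            rw [Fin.snoc_castSucc, Fin.succ_castSucc, Fin.snoc_castSucc]
            exact hs k
        · rw [Fin.strictMono_iff_lt_succ] at hmono ⊢
          intro k
          induction k using Fin.lastCases with
          | last =>
            rw [Fin.snoc_castSucc, hlast, Fin.succ_last, Fin.snoc_last]
            exact hbj
          | cast k =>
            rw [Fin.snoc_castSucc, Fin.succ_castSucc, Fin.snoc_castSucc]
            exact hmono k
      · refine Or.inr ?_
        rw [add_mul, one_mul]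
        exact (formInst F).mem_reach_trans hreach hnear

open Classical in
/-- The number of pairs of variables whose values have a common influence. -/
noncomputable def interCount (F : ι → NAEClause K n) (ρ : ℕ) : ℕ :=
  #{jk : Fin n × Fin n |
    ∃ i, Influences (formInst F) ρ i jk.1 ∧ Influences (formInst F) ρ i jk.2}

open Classical in
theorem interCount_le (F : ι → NAEClause K n) (ρ l : ℕ) :
    interCount F ρ ≤ 2 * n * #{s ∈ walks (Near F ρ) l | StrictMono s} +
      ∑ j, ((formInst F).reach (l * ρ + l * ρ) {j}).ncard := by
  set B : Finset (Fin n) := {s ∈ walks (Near F ρ) l | StrictMono s}.image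
    fun s => s (Fin.last l) with hB
  have hBc : #B ≤ #{s ∈ walks (Near F ρ) l | StrictMono s} := card_image_le
  have hsub : (univ.filter fun jk : Fin n × Fin n =>
      ∃ i, Influences (formInst F) ρ i jk.1 ∧ Influences (formInst F) ρ i jk.2) ⊆
      (B ×ˢ univ ∪ univ ×ˢ B) ∪ univ.biUnion fun j : Fin n =>
        ({j} : Finset (Fin n)) ×ˢ ((formInst F).reach (l * ρ + l * ρ) {j}).toFinset := by
    rintro ⟨j, k⟩ hjk
    obtain ⟨i, hij, hik⟩ := (mem_filter.1 hjk).2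
    simp only at hij hik
    have hmem : ∀ {a : Fin n}, Influences (formInst F) ρ i a →
        a ∈ B ∨ a ∈ (formInst F).reach (l * ρ) {i} := by
      intro a ha
      refine (exists_walk_or_mem_reach ha l).imp_left ?_
      rintro ⟨s, hs, hm, hl⟩
      exact mem_image.2 ⟨s, mem_filter.2 ⟨hs, hm⟩, hl⟩
    rcases hmem hij with hj | hj
    · exact mem_union_left _ (mem_union_left _ (by simp [hj]))
    rcases hmem hik with hk | hk
    · exact mem_union_left _ (mem_union_right _ (by simp [hk]))
    -- If neither variable ends a long increasing walk, both are within `l * ρ` steps of their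
    -- common influence.
    refine mem_union_right _ (mem_biUnion.2 ⟨j, mem_univ _, ?_⟩)
    rw [mem_product, Set.mem_toFinset]
    exact ⟨by simp, (formInst F).mem_reach_trans ((formInst F).mem_reach_comm hj) hk⟩
  refine (card_le_card hsub).trans ((card_union_le _ _).trans (add_le_add ?_ ?_))
  · refine (card_union_le _ _).trans ?_
    rw [card_product, card_product, card_univ, Fintype.card_fin]
    nlinarith
  · refine card_biUnion_le.trans (sum_le_sum fun j _ => ?_)
    rw [card_product, card_singleton, one_mul, Set.ncard_eq_toFinset_card']

variable [Fintype ι] [DecidableEq ι]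

open Classical in
/-- The probability that a given sequence of variables is a walk in the random formula. -/
noncomputable def walkProb (K : ℕ) (ι : Type) [Fintype ι] [DecidableEq ι] {n : ℕ} (ρ : ℕ) {l : ℕ}
    (s : Fin (l + 1) → Fin n) : ℝ :=
  𝔼 F : ι → NAEClause K n, if s ∈ walks (Near F ρ) l then 1 else 0

theorem walkProb_comp (ρ : ℕ) {l : ℕ} (s : Fin (l + 1) → Fin n) (π : Equiv.Perm (Fin n)) :
    walkProb K ι ρ (π ∘ s) = walkProb K ι ρ s := by
  classical
  refine Fintype.expect_equiv (Equiv.piCongrRight fun _ => NAEClause.rename π) _ _ fun F => ?_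
  refine if_congr ?_ rfl rfl
  simp only [mem_walks, Near]
  refine forall_congr' fun j => ?_
  exact (mem_reach_rename π F ρ _ _).symm

theorem walkProb_eq_of_injective (ρ : ℕ) {l : ℕ} {s s' : Fin (l + 1) → Fin n}
    (hs : s.Injective) (hs' : s'.Injective) : walkProb K ι ρ s = walkProb K ι ρ s' := by
  obtain ⟨π, hπ⟩ := (Equiv.Perm.isMultiplyPretransitive (Fin n) (l + 1)).exists_smul_eq
    ⟨s, hs⟩ ⟨s', hs'⟩
  rw [← walkProb_comp ρ s π]
  congr 1
  funext j
  exact DFunLike.congr_fun hπ j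

open Classical in
-- Renaming invariance makes all injective sequences equally likely to be walks, and the
-- rearrangements of increasing sequences are pairwise distinct.
theorem sum_walkProb_strictMono_le (ρ l : ℕ) :
    ((l + 1).factorial : ℝ) * ∑ s : Fin (l + 1) → Fin n with StrictMono s, walkProb K ι ρ s ≤
      ∑ s : Fin (l + 1) → Fin n, walkProb K ι ρ s := by
  have hnn : ∀ s : Fin (l + 1) → Fin n, 0 ≤ walkProb K ι ρ s := fun s =>
    expect_nonneg fun _ _ => by split_ifs <;> simp
  have h1 : ((l + 1).factorial : ℝ) *
      ∑ s : Fin (l + 1) → Fin n with StrictMono s, walkProb K ι ρ s =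
      ∑ p ∈ (univ : Finset (Equiv.Perm (Fin (l + 1)))) ×ˢ
        univ.filter (fun s : Fin (l + 1) → Fin n => StrictMono s), walkProb K ι ρ (p.2 ∘ p.1) := by
    rw [sum_product]
    have : ∀ π : Equiv.Perm (Fin (l + 1)),
        ∑ s : Fin (l + 1) → Fin n with StrictMono s, walkProb K ι ρ (s ∘ π) =
        ∑ s : Fin (l + 1) → Fin n with StrictMono s, walkProb K ι ρ s := fun π =>
      sum_congr rfl fun s hs => by
        have hs := (mem_filter.1 hs).2.injective
        exact walkProb_eq_of_injective ρ (hs.comp π.injective) hs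
    simp only [this, sum_const, card_univ, Fintype.card_perm, Fintype.card_fin, nsmul_eq_mul]
  rw [h1, ← sum_image (g := fun p : Equiv.Perm (Fin (l + 1)) × (Fin (l + 1) → Fin n) => p.2 ∘ p.1)
    (f := fun s => walkProb K ι ρ s)]
  · exact sum_le_univ_sum_of_nonneg hnn
  · rintro ⟨π, s⟩ hp ⟨π', s'⟩ hp' he
    simp only [coe_product, Set.mem_prod, coe_filter, Set.mem_ofPred_eq, mem_univ, true_and,
      coe_univ, Set.mem_univ] at hp hp' he
    have hrange : Set.range s = Set.range s' := by
      rw [← π.surjective.range_comp s, he, π'.surjective.range_comp s']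
    have hss : s = s' := (StrictMono.range_inj hp hp').1 hrange
    subst hss
    refine Prod.ext (Equiv.ext fun j => ?_) rfl
    exact hp.injective (congrFun he j)

open Classical in
-- The bound `x ^ l ≤ l! / 2 ^ l * exp (2 x)` for valencies, with the factor `l + 1` from the walk
-- count, costs exactly the `(l + 1)!` gained from monotonicity. The parameter 2 in the exponent
-- leaves the decay `2 ^ (-l)`.
theorem expect_card_strictMono_walks_le [Nonempty (NAEClause K n)] {d : ℝ} (hd : 0 ≤ d)
    (hn : 0 < n) (hm : (Fintype.card ι : ℝ) ≤ d * n) (ρ l : ℕ) :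
    𝔼 F : ι → NAEClause K n, (#{s ∈ walks (Near F ρ) l | StrictMono s} : ℝ) ≤
      n * Real.exp (growthRate d K 2 ρ) / 2 ^ l := by
  set E := Real.exp (growthRate d K 2 ρ) with hE
  have h1 : (𝔼 F : ι → NAEClause K n, (#{s ∈ walks (Near F ρ) l | StrictMono s} : ℝ)) =
      ∑ s : Fin (l + 1) → Fin n with StrictMono s, walkProb K ι ρ s := by
    simp only [walkProb]
    rw [← expect_sum_comm]
    refine expect_congr rfl fun F _ => ?_
    rw [sum_ite, sum_const_zero, add_zero, sum_const, nsmul_eq_mul, mul_one, filter_filter]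
    congr 2
    ext s
    simp [and_comm]
  have h2 : (∑ s : Fin (l + 1) → Fin n, walkProb K ι ρ s) =
      𝔼 F : ι → NAEClause K n, (#(walks (Near F ρ) l) : ℝ) := by
    simp only [walkProb]
    rw [← expect_sum_comm]
    refine expect_congr rfl fun F _ => ?_
    simp
  have h3 : (∑ s : Fin (l + 1) → Fin n, walkProb K ι ρ s) ≤
      (l + 1) * (n * (l.factorial / 2 ^ l * E)) := by
    rw [h2]
    have h4 : ∀ F : ι → NAEClause K n, (#(walks (Near F ρ) l) : ℝ) ≤ (l + 1) * ∑ v : Fin n,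
        (l.factorial : ℝ) / 2 ^ l * Real.exp (2 * ((formInst F).reach ρ {v}).ncard) := by
      intro F
      have h5 := card_walks_le (Near F ρ)
        (fun v w h => (formInst F).mem_reach_comm (R := ρ) h) l
      have h6 : (#(walks (Near F ρ) l) : ℝ) ≤ (l + 1) * ∑ v, (valency (Near F ρ) v : ℝ) ^ l := by
        exact_mod_cast h5
      refine h6.trans ?_
      gcongr with v
      rw [valency_near]
      have h7 := Real.pow_div_factorial_le_exp
        (2 * ((formInst F).reach ρ {v}).ncard : ℝ) (by positivity) l
      have h8 : (0 : ℝ) < l.factorial := by positivity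
      rw [mul_pow, div_le_iff₀ h8] at h7
      rw [div_mul_eq_mul_div, le_div_iff₀ (by positivity)]
      linarith
    refine (expect_le_expect fun F _ => h4 F).trans ?_
    rw [← mul_expect, expect_sum_comm]
    gcongr
    refine (sum_le_sum fun v _ => ?_ : _ ≤ ∑ v : Fin n, (l.factorial : ℝ) / 2 ^ l * E).trans ?_
    · rw [← mul_expect]
      gcongr
      exact expect_exp_reach_le hd (by norm_num) hn ρ hm v
    · simp
  have h9 := (sum_walkProb_strictMono_le (K := K) (ι := ι) (n := n) ρ l).trans h3
  rw [h1]
  rw [Nat.factorial_succ] at h9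
  push_cast at h9
  have h10 : (0 : ℝ) < (l + 1) * l.factorial := by positivity
  refine le_of_mul_le_mul_left (h9.trans (le_of_eq ?_)) h10
  ring

theorem expect_interCount_le [Nonempty (NAEClause K n)] {d : ℝ} (hd : 0 ≤ d)
    (hn : 0 < n) (hm : (Fintype.card ι : ℝ) ≤ d * n) (ρ l : ℕ) :
    𝔼 F : ι → NAEClause K n, (interCount F ρ : ℝ) ≤
      2 * Real.exp (growthRate d K 2 ρ) / 2 ^ l * n ^ 2 +
        Real.exp (growthRate d K 1 (l * ρ + l * ρ)) * n := by
  classical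
  have h1 : ∀ F : ι → NAEClause K n, (interCount F ρ : ℝ) ≤
      2 * n * (#{s ∈ walks (Near F ρ) l | StrictMono s} : ℝ) +
        ∑ j, Real.exp (1 * ((formInst F).reach (l * ρ + l * ρ) {j}).ncard) := by
    intro F
    have h := interCount_le F ρ l
    have h' : (interCount F ρ : ℝ) ≤ 2 * n * (#{s ∈ walks (Near F ρ) l | StrictMono s} : ℝ) +
      ∑ j, (((formInst F).reach (l * ρ + l * ρ) {j}).ncard : ℝ) := by exact_mod_cast h
    refine h'.trans (add_le_add le_rfl (sum_le_sum fun j _ => ?_))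
    rw [one_mul]
    linarith [Real.add_one_le_exp (((formInst F).reach (l * ρ + l * ρ) {j}).ncard : ℝ)]
  refine (expect_le_expect fun F _ => h1 F).trans ?_
  rw [expect_add_distrib, ← mul_expect, expect_sum_comm]
  refine add_le_add ?_ ?_
  · have := expect_card_strictMono_walks_le (K := K) (ι := ι) hd hn hm ρ l
    calc 2 * (n : ℝ) * _ ≤ 2 * n * (n * Real.exp (growthRate d K 2 ρ) / 2 ^ l) := by gcongr
      _ = _ := by ring
  · refine (sum_le_sum fun j _ => expect_exp_reach_le hd zero_le_one hn _ hm j).trans ?_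
    simp [mul_comm]

theorem eventually_expect_interCount_le (K ρ : ℕ) {d : ℝ} (hd : 0 ≤ d) {ε : ℝ} (hε : 0 < ε) :
    ∀ᶠ n : ℕ in Filter.atTop, Nonempty (NAEClause K n) →
      𝔼 F : Fin ⌊d * n⌋₊ → NAEClause K n, (interCount F ρ : ℝ) ≤ ε * n ^ 2 := by
  -- The length `l` is fixed before `n`, so the term from short chains is only linear in `n`.
  obtain ⟨l, hl⟩ : ∃ l : ℕ, 2 * Real.exp (growthRate d K 2 ρ) / 2 ^ l ≤ ε / 2 := by
    have h := (tendsto_pow_atTop_nhds_zero_of_lt_one (r := (1 / 2 : ℝ)) (by norm_num)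
      (by norm_num)).const_mul (2 * Real.exp (growthRate d K 2 ρ))
    rw [mul_zero] at h
    obtain ⟨l, hl⟩ := (h.eventually_le_const (half_pos hε)).exists
    refine ⟨l, ?_⟩
    rwa [one_div, inv_pow, ← div_eq_mul_inv] at hl
  obtain ⟨n₀, hn₀⟩ := exists_nat_ge (Real.exp (growthRate d K 1 (l * ρ + l * ρ)) / (ε / 2))
  filter_upwards [Filter.eventually_ge_atTop (max n₀ 1)] with n hn hne
  have hn1 : 0 < n := lt_of_lt_of_le (by simp) hn
  have hn2 : (n₀ : ℝ) ≤ n := by exact_mod_cast (le_max_left _ _).trans hn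
  refine (expect_interCount_le hd hn1 ?_ ρ l).trans ?_
  · rw [Fintype.card_fin]
    exact Nat.floor_le (by positivity)
  · have h1 := hn₀.trans hn2
    rw [div_le_iff₀ (half_pos hε)] at h1
    have h2 : (0 : ℝ) < n := by exact_mod_cast hn1
    nlinarith [mul_le_mul_of_nonneg_right h1 h2.le, mul_le_mul_of_nonneg_right hl (sq_nonneg (n : ℝ))]

theorem nonempty_clause (h : K ≤ n) : Nonempty (NAEClause K n) := by
  obtain ⟨s, -, hs⟩ := exists_subset_card_eq (s := (univ : Finset (Fin n))) (n := K) (by simpa)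
  refine ⟨⟨fun v => if v ∈ s then some true else none, ?_⟩⟩
  rw [← hs]
  congr 1
  ext v
  by_cases hv : v ∈ s <;> simp [hv]

end Symmetry

end Chains

/-! ### First moment of spread triples of solutions -/

section FirstMoment

open Finset BigOperators

variable {K n : ℕ}

/-- The clause `c` has a true and a false literal under `σ`. -/
def NAEClause.SatBy (c : NAEClause K n) (σ : Fin n → Bool) : Prop :=
  ∀ a, ∃ v p, c.1 v = some p ∧ litVal p (σ v) = a

/-- The literals on the variables of `e` all of which have the value `a` under `σ`. -/
def constLits (σ : Fin n → Bool) (e : Finset (Fin n)) (a : Bool) : Fin n → Option Bool :=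
  fun v => if v ∈ e then some (a == σ v) else none

theorem litVal_eq_iff (p b a : Bool) : litVal p b = a ↔ p = (a == b) := by
  cases p <;> cases b <;> cases a <;> decide

theorem isSome_constLits (σ : Fin n → Bool) (e : Finset (Fin n)) (a : Bool) (v : Fin n) :
    (constLits σ e a v).isSome = true ↔ v ∈ e := by
  by_cases h : v ∈ e <;> simp [constLits, h]

open Classical in
theorem two_mul_choose_le_card_unsat (hK : 0 < K) (σ : Fin n → Bool) :
    2 * n.choose K ≤ #{c : NAEClause K n | ¬ c.SatBy σ} := by
  rw [← card_image_of_injective _ Subtype.val_injective]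
  have h1 : #((powersetCard K (univ : Finset (Fin n))) ×ˢ (univ : Finset Bool)) =
      2 * n.choose K := by
    simp [card_product, mul_comm]
  rw [← h1]
  refine card_le_card_of_injOn (fun p => constLits σ p.1 p.2) ?_ ?_
  · rintro ⟨e, a⟩ he
    simp only [coe_product, Set.mem_prod, mem_coe, mem_powersetCard] at he
    simp only [mem_coe, mem_image, mem_filter, mem_univ, true_and]
    refine ⟨⟨constLits σ e a, ?_⟩, ?_, rfl⟩
    · rw [← he.1.2]
      congr 1
      ext v
      simp [isSome_constLits]
    · intro hsat
      obtain ⟨v, p, hv, hp⟩ := hsat (!a)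
      simp only [constLits] at hv
      split_ifs at hv
      rw [Option.some_inj] at hv
      have := (litVal_eq_iff p (σ v) a).2 hv.symm
      rw [hp] at this
      cases a <;> simp at this
  · rintro ⟨e, a⟩ he ⟨e', a'⟩ he' heq
    simp only [coe_product, Set.mem_prod, mem_coe, mem_powersetCard] at he he' heq
    have hee : e = e' := by
      ext v
      rw [← isSome_constLits σ e a v, ← isSome_constLits σ e' a' v, heq]
    subst hee
    obtain ⟨v, hv⟩ : e.Nonempty := card_pos.1 (by rw [he.1.2]; exact hK)
    have h := congrFun heq v
    simp only [constLits, if_pos hv, Option.some_inj] at h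
    refine Prod.ext rfl ?_
    revert h
    cases a <;> cases a' <;> cases σ v <;> simp

open Classical in
-- A clause violated by both assignments has constant literal values under each. If the two
-- constants agree, its variables all lie where the assignments agree; otherwise, all where they
-- differ.
theorem card_unsat_both_le (σ σ' : Fin n → Bool) :
    #{c : NAEClause K n | ¬ c.SatBy σ ∧ ¬ c.SatBy σ'} ≤
      2 * ((n - hammingDist σ σ').choose K + (hammingDist σ σ').choose K) := by
  rw [← card_image_of_injective _ Subtype.val_injective]
  set D : Finset (Fin n) := univ.filter fun v => σ v ≠ σ' v with hD
  have hDc : #D = hammingDist σ σ' := rfl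
  have hsub : ({c : NAEClause K n | ¬ c.SatBy σ ∧ ¬ c.SatBy σ'} : Finset _).image Subtype.val ⊆
      ((powersetCard K Dᶜ ∪ powersetCard K D) ×ˢ (univ : Finset Bool)).image
        fun p => constLits σ p.1 p.2 := by
    intro l hl
    obtain ⟨(c : NAEClause K n), hc, rfl⟩ := mem_image.1 hl
    obtain ⟨h1, h2⟩ := (mem_filter.1 hc).2
    unfold NAEClause.SatBy at h1 h2
    push Not at h1 h2
    obtain ⟨a, ha⟩ := h1
    obtain ⟨a', ha'⟩ := h2
    have hp : ∀ v p, c.1 v = some p → p = ((!a) == σ v) := fun v p hv =>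
      (litVal_eq_iff _ _ _).1 (by have := ha v p hv; revert this; cases litVal p (σ v) <;> cases a <;> simp)
    have hp' : ∀ v p, c.1 v = some p → p = ((!a') == σ' v) := fun v p hv =>
      (litVal_eq_iff _ _ _).1 (by have := ha' v p hv; revert this; cases litVal p (σ' v) <;> cases a' <;> simp)
    have hval : ∀ v ∈ c.vars, ∃ p, c.1 v = some p := fun v hv =>
      Option.isSome_iff_exists.1 ((c.mem_vars v).1 hv)
    refine mem_image.2 ⟨(c.vars, !a), ?_, ?_⟩
    · simp only [mem_product, mem_union, mem_powersetCard, mem_univ, and_true, c.card_vars]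
      by_cases haa : a = a'
      · refine Or.inl fun v hv => ?_
        obtain ⟨p, hpv⟩ := hval v hv
        have e1 := hp v p hpv
        have e2 := hp' v p hpv
        simp only [hD, mem_compl, mem_filter, mem_univ, true_and, not_not]
        rw [e1, haa] at e2
        revert e2
        cases a' <;> cases σ v <;> cases σ' v <;> simp
      · refine Or.inr fun v hv => ?_
        obtain ⟨p, hpv⟩ := hval v hv
        have e1 := hp v p hpv
        have e2 := hp' v p hpv
        simp only [hD, mem_filter, mem_univ, true_and]
        rw [e1] at e2
        revert e2 haa
        cases a <;> cases a' <;> cases σ v <;> cases σ' v <;> simp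
    · funext v
      by_cases hv : v ∈ c.vars
      · obtain ⟨p, hpv⟩ := hval v hv
        simp only [constLits, if_pos hv]
        rw [hpv, ← hp v p hpv]
      · simp only [constLits, if_neg hv]
        rw [c.mem_vars, Bool.not_eq_true, Option.isSome_eq_false_iff, Option.isNone_iff_eq_none] at hv
        exact hv.symm
  refine (card_le_card hsub).trans (card_image_le.trans ?_)
  rw [card_product, card_univ, Fintype.card_bool, mul_comm]
  refine Nat.mul_le_mul_left 2 ((card_union_le _ _).trans ?_)
  rw [card_powersetCard, card_powersetCard, card_compl, Fintype.card_fin, hDc]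

theorem card_clauses_le : Fintype.card (NAEClause K n) ≤ n.choose K * 2 ^ K := by
  classical
  have h1 : #((powersetCard K (univ : Finset (Fin n))).sigma fun e => e.powerset) =
      n.choose K * 2 ^ K := by
    rw [card_sigma, sum_congr rfl fun e he => by rw [card_powerset, (mem_powersetCard.1 he).2]]
    simp
  rw [← h1, ← card_univ]
  refine card_le_card_of_injOn (fun c => ⟨c.vars, c.vars.filter fun v => c.1 v = some true⟩) ?_ ?_
  · intro c _
    simp only [mem_coe, mem_sigma, mem_powersetCard, mem_powerset]
    exact ⟨⟨subset_univ _, c.card_vars⟩, filter_subset _ _⟩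
  · intro c _ c' _ h
    simp only [Sigma.mk.injEq] at h
    obtain ⟨hv, ht⟩ := h
    rw [← hv] at ht
    have ht := eq_of_heq ht
    refine Subtype.ext (funext fun v => ?_)
    have h2 := Finset.ext_iff.1 hv v
    have h3 := Finset.ext_iff.1 ht v
    simp only [NAEClause.mem_vars, mem_filter] at h2 h3
    revert h2 h3
    rcases c.1 v with _ | _ | _ <;> rcases c'.1 v with _ | _ | _ <;> simp

/-- Factor by factor, `(j - i) / (n - i) ≤ j / n`. -/
theorem descFactorial_mul_pow_le {j n : ℕ} (h : j ≤ n) (K : ℕ) :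
    j.descFactorial K * n ^ K ≤ n.descFactorial K * j ^ K := by
  induction K with
  | zero => simp
  | succ K ih =>
    rw [Nat.descFactorial_succ, Nat.descFactorial_succ, pow_succ, pow_succ]
    have h1 : (j - K) * n ≤ (n - K) * j := by
      rw [Nat.sub_mul, Nat.sub_mul, mul_comm n j]
      exact Nat.sub_le_sub_left (Nat.mul_le_mul_left K h) _
    calc (j - K) * j.descFactorial K * (n ^ K * n)
        = ((j - K) * n) * (j.descFactorial K * n ^ K) := by ring
      _ ≤ ((n - K) * j) * (n.descFactorial K * j ^ K) := Nat.mul_le_mul h1 ih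
      _ = _ := by ring

theorem choose_le_pow_mul_choose {j n : ℕ} (hn : 0 < n) (h : j ≤ n) {x : ℝ} (hj : (j : ℝ) ≤ x * n)
    (K : ℕ) : (j.choose K : ℝ) ≤ x ^ K * n.choose K := by
  have h1 := descFactorial_mul_pow_le h K
  rw [Nat.descFactorial_eq_factorial_mul_choose, Nat.descFactorial_eq_factorial_mul_choose,
    mul_assoc, mul_assoc] at h1
  have h2 := Nat.le_of_mul_le_mul_left h1 K.factorial_pos
  have h3 : (j.choose K : ℝ) * n ^ K ≤ n.choose K * (j : ℝ) ^ K := by exact_mod_cast h2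
  have hn' : (0 : ℝ) < (n : ℝ) ^ K := by positivity
  refine le_of_mul_le_mul_right (h3.trans ?_) hn'
  calc (n.choose K : ℝ) * (j : ℝ) ^ K ≤ n.choose K * (x * n) ^ K := by gcongr
    _ = _ := by ring

open Classical in
-- Bonferroni in units of `n.choose K`: three single violations count at least 2 each and three
-- joint ones at most 1/25 each, leaving `6 - 3/25 = 147/25`.
theorem card_satBy_three_le (hK : 0 < K) (hn : 0 < n) {a b : ℝ} (hab : b ≤ 1 - a)
    (hKa : 2 * (1 - a) ^ K ≤ 1 / 50) (σ : Fin 3 → Fin n → Bool)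
    (hσ : ∀ k l, k ≠ l →
      a * n ≤ hammingDist (σ k) (σ l) ∧ (hammingDist (σ k) (σ l) : ℝ) ≤ b * n) :
    (#{c : NAEClause K n | ∀ k, c.SatBy (σ k)} : ℝ) ≤
      Fintype.card (NAEClause K n) * (1 - 147 / 25 / 2 ^ K) := by
  set u : Fin 3 → NAEClause K n → ℝ := fun k c => if c.SatBy (σ k) then 0 else 1 with hu
  have hone : ∀ k, 2 * (n.choose K : ℝ) ≤ ∑ c, u k c := by
    intro k
    have h := two_mul_choose_le_card_unsat hK (σ k)
    have h2 : (∑ c, u k c) = (#{c : NAEClause K n | ¬ c.SatBy (σ k)} : ℝ) := by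
      rw [Finset.card_filter]
      push_cast
      refine sum_congr rfl fun c _ => ?_
      by_cases hc : c.SatBy (σ k) <;> simp [hu, hc]
    rw [h2]
    exact_mod_cast h
  have htwo : ∀ k l, k ≠ l → ∑ c, u k c * u l c ≤ 1 / 25 * n.choose K := by
    intro k l hkl
    have h := card_unsat_both_le (K := K) (σ k) (σ l)
    have h2 : (∑ c, u k c * u l c) =
        (#{c : NAEClause K n | ¬ c.SatBy (σ k) ∧ ¬ c.SatBy (σ l)} : ℝ) := by
      rw [Finset.card_filter]
      push_cast
      refine sum_congr rfl fun c _ => ?_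
      by_cases hc : c.SatBy (σ k) <;> by_cases hc' : c.SatBy (σ l) <;> simp [hu, hc, hc']
    have hle : hammingDist (σ k) (σ l) ≤ n := by
      simpa using hammingDist_le_card_fintype (x := σ k) (y := σ l)
    obtain ⟨h3, h4⟩ := hσ k l hkl
    have hn' : (0 : ℝ) ≤ n := by positivity
    have e1 := choose_le_pow_mul_choose hn (Nat.sub_le n (hammingDist (σ k) (σ l))) (x := 1 - a)
      (by rw [Nat.cast_sub hle]; linarith) K
    have e2 := choose_le_pow_mul_choose hn hle (x := 1 - a)
      (h4.trans (mul_le_mul_of_nonneg_right hab hn')) K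
    rw [h2]
    have h' : (#{c : NAEClause K n | ¬ c.SatBy (σ k) ∧ ¬ c.SatBy (σ l)} : ℝ) ≤
      2 * (((n - hammingDist (σ k) (σ l)).choose K : ℕ) + ((hammingDist (σ k) (σ l)).choose K : ℕ)) := by
      exact_mod_cast h
    have hc0 : (0 : ℝ) ≤ n.choose K := by positivity
    nlinarith [mul_le_mul_of_nonneg_right hKa hc0]
  have hpt : ∀ c : NAEClause K n, (if ∀ k, c.SatBy (σ k) then (1 : ℝ) else 0) ≤
      1 - u 0 c - u 1 c - u 2 c + u 0 c * u 1 c + u 0 c * u 2 c + u 1 c * u 2 c := by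
    intro c
    simp only [Fin.forall_fin_succ, Fin.succ_zero_eq_one, Fin.succ_one_eq_two, IsEmpty.forall_iff,
      and_true, hu]
    by_cases h0 : c.SatBy (σ 0) <;> by_cases h1 : c.SatBy (σ 1) <;>
      by_cases h2 : c.SatBy (σ 2) <;> simp [h0, h1, h2]
  have hsum : (#{c : NAEClause K n | ∀ k, c.SatBy (σ k)} : ℝ) ≤
      Fintype.card (NAEClause K n) - 147 / 25 * n.choose K := by
    rw [Finset.card_filter]
    push_cast
    refine (sum_le_sum fun c _ => hpt c).trans ?_
    simp only [sum_add_distrib, sum_sub_distrib, sum_const, card_univ, nsmul_eq_mul, mul_one]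
    linarith [hone 0, hone 1, hone 2, htwo 0 1 (by decide), htwo 0 2 (by decide),
      htwo 1 2 (by decide)]
  refine hsum.trans ?_
  have hc : (Fintype.card (NAEClause K n) : ℝ) ≤ n.choose K * 2 ^ K := by
    exact_mod_cast card_clauses_le (K := K) (n := n)
  have h2 : (0 : ℝ) < 2 ^ K := by positivity
  have h3 : (Fintype.card (NAEClause K n) : ℝ) / 2 ^ K ≤ n.choose K := by
    rwa [div_le_iff₀ h2]
  have : (Fintype.card (NAEClause K n) : ℝ) * (1 - 147 / 25 / 2 ^ K) =
    Fintype.card (NAEClause K n) - 147 / 25 * (Fintype.card (NAEClause K n) / 2 ^ K) := by ring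
  rw [this]
  linarith

/-- Chernoff bound with weight 1/16 for every disagreement. -/
theorem card_hamming_ball_le (σ : Fin n → Bool) (b : ℝ) :
    (#{σ' : Fin n → Bool | (hammingDist σ σ' : ℝ) ≤ b * n} : ℝ) ≤
      Real.exp ((b * Real.log 16 + 1 / 16) * n) := by
  have h1 : ∑ σ' : Fin n → Bool, (1 / 16 : ℝ) ^ hammingDist σ σ' = (1 + 1 / 16) ^ n := by
    have h2 : ∀ σ' : Fin n → Bool, (1 / 16 : ℝ) ^ hammingDist σ σ' =
        ∏ i, if σ i ≠ σ' i then (1 / 16 : ℝ) else 1 := by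
      intro σ'
      rw [prod_ite, prod_const, prod_const_one, mul_one]
      rfl
    have h3 := prod_univ_sum (fun _ : Fin n => (univ : Finset Bool))
      (fun i b => if σ i ≠ b then (1 / 16 : ℝ) else 1)
    rw [Fintype.piFinset_univ] at h3
    simp only [h2]
    rw [← h3]
    have h4 : ∀ i, (∑ b : Bool, if σ i ≠ b then (1 / 16 : ℝ) else 1) = 1 + 1 / 16 := by
      intro i
      rw [Fintype.sum_bool]
      cases σ i <;> norm_num
    rw [prod_congr rfl fun i _ => h4 i]
    simp
  have hlog : (16 : ℝ) = Real.exp (Real.log 16) := (Real.exp_log (by norm_num)).symm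
  have h5 : (#{σ' : Fin n → Bool | (hammingDist σ σ' : ℝ) ≤ b * n} : ℝ) *
      Real.exp (-(b * Real.log 16 * n)) ≤ (1 + 1 / 16) ^ n := by
    rw [← h1, Finset.card_filter]
    push_cast
    rw [sum_mul]
    refine sum_le_sum fun σ' _ => ?_
    split_ifs with h
    · rw [one_mul]
      have : (1 / 16 : ℝ) ^ hammingDist σ σ' = Real.exp (-(hammingDist σ σ' * Real.log 16)) := by
        rw [Real.exp_neg, Real.exp_nat_mul, ← hlog, one_div, inv_pow]
      rw [this]
      refine Real.exp_le_exp.2 ?_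
      have : 0 ≤ Real.log 16 := Real.log_nonneg (by norm_num)
      nlinarith
    · rw [zero_mul]; positivity
  have h6 : ((1 : ℝ) + 1 / 16) ^ n ≤ Real.exp (1 / 16 * n) := by
    rw [mul_comm, Real.exp_nat_mul]
    gcongr
    linarith [Real.add_one_le_exp (1 / 16 : ℝ)]
  have h7 := h5.trans h6
  rw [Real.exp_neg, mul_inv_le_iff₀ (Real.exp_pos _), ← Real.exp_add] at h7
  refine h7.trans (le_of_eq ?_)
  ring_nf

/-- The triples of assignments with pairwise distances between `a n` and `b n`. -/
def IsSpread (a b : ℝ) (σ : Fin 3 → Fin n → Bool) : Prop :=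
  ∀ k l, k ≠ l → a * n ≤ hammingDist (σ k) (σ l) ∧ (hammingDist (σ k) (σ l) : ℝ) ≤ b * n

open Classical in
theorem card_isSpread_le (a b : ℝ) :
    (#{σ : Fin 3 → Fin n → Bool | IsSpread a b σ} : ℝ) ≤
      2 ^ n * Real.exp ((b * Real.log 16 + 1 / 16) * n) ^ 2 := by
  set N : (Fin n → Bool) → Finset (Fin n → Bool) :=
    fun σ => {σ' : Fin n → Bool | (hammingDist σ σ' : ℝ) ≤ b * n} with hN
  have h1 : #{σ : Fin 3 → Fin n → Bool | IsSpread a b σ} ≤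
      #((univ : Finset (Fin n → Bool)).sigma fun σ => N σ ×ˢ N σ) := by
    refine card_le_card_of_injOn (fun σ => ⟨σ 0, σ 1, σ 2⟩) ?_ ?_
    · intro σ hσ
      have hσ' := (mem_filter.1 (mem_coe.1 hσ)).2
      simp only [mem_coe, mem_sigma, mem_univ, true_and, mem_product, hN, mem_filter]
      exact ⟨(hσ' 0 1 (by decide)).2, (hσ' 0 2 (by decide)).2⟩
    · intro σ _ σ' _ h
      simp only [Sigma.mk.injEq, heq_eq_eq, Prod.mk.injEq] at h
      funext k
      fin_cases k
      · exact h.1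
      · exact h.2.1
      · exact h.2.2
  rw [card_sigma] at h1
  have h2 : (#{σ : Fin 3 → Fin n → Bool | IsSpread a b σ} : ℝ) ≤
      ∑ σ : Fin n → Bool, (#(N σ) : ℝ) ^ 2 := by
    refine (Nat.cast_le.2 h1).trans (le_of_eq ?_)
    push_cast
    exact sum_congr rfl fun σ _ => by rw [card_product, Nat.cast_mul, sq]
  refine h2.trans ((sum_le_sum fun σ _ => pow_le_pow_left₀ (by positivity)
    (card_hamming_ball_le σ b) 2).trans (le_of_eq ?_))
  simp

/-- Every assignment satisfying an instance satisfies its clauses. -/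
theorem satBy_of_sat {m : ℕ} (hK : 0 < K) {F : Fin m → NAEClause K n} {σ : Fin n → Bool}
    (h : (toInst F).Sat σ) (c : Fin m) : (F c).SatBy σ := by
  obtain ⟨v, hv⟩ : (F c).vars.Nonempty := card_pos.1 (by rw [NAEClause.card_vars]; exact hK)
  obtain ⟨h1, h2⟩ := h c ⟨v, (formInst_occurs F c v).2 hv⟩
  rintro (_ | _)
  · exact h1 (by simp [toInst])
  · exact h2 (by simp [toInst])

/-- The formula has a spread triple of satisfying assignments. -/
def HasSpreadTriple {m : ℕ} (a b : ℝ) (F : Fin m → NAEClause K n) : Prop :=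
  ∃ σ : Fin 3 → Fin n → Bool, (∀ k, (toInst F).Sat (σ k)) ∧ IsSpread a b σ

open Classical in
theorem expect_hasSpreadTriple_le [Nonempty (NAEClause K n)] {m : ℕ} (hK : 0 < K) (hn : 0 < n)
    {a b : ℝ} (hab : b ≤ 1 - a) (hKa : 2 * (1 - a) ^ K ≤ 1 / 50) :
    𝔼 F : Fin m → NAEClause K n, (if HasSpreadTriple a b F then (1 : ℝ) else 0) ≤
      2 ^ n * Real.exp ((b * Real.log 16 + 1 / 16) * n) ^ 2 *
        Real.exp (-(147 / 25 / 2 ^ K * m)) := by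
  have hone : ∀ σ : Fin 3 → Fin n → Bool, IsSpread a b σ →
      𝔼 F : Fin m → NAEClause K n, (if ∀ k, (toInst F).Sat (σ k) then (1 : ℝ) else 0) ≤
        Real.exp (-(147 / 25 / 2 ^ K * m)) := by
    intro σ hσ
    set G : Finset (NAEClause K n) := univ.filter fun c => ∀ k, c.SatBy (σ k) with hG
    have hc : (0 : ℝ) < Fintype.card (NAEClause K n) := by exact_mod_cast Fintype.card_pos
    have h1 : (#G : ℝ) ≤ _ := card_satBy_three_le hK hn hab hKa σ hσ
    rw [Fintype.expect_eq_sum_div_card, Fintype.card_fun, Fintype.card_fin]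
    have h2 : (∑ F : Fin m → NAEClause K n, if ∀ k, (toInst F).Sat (σ k) then (1 : ℝ) else 0) ≤
        (#G : ℝ) ^ m := by
      rw [← sum_filter, sum_const, nsmul_eq_mul, mul_one]
      have h3 : #(Fintype.piFinset fun _ : Fin m => G) = #G ^ m := by simp
      rw [← Nat.cast_pow, ← h3]
      refine Nat.cast_le.2 (card_le_card fun F hF => ?_)
      rw [Fintype.mem_piFinset]
      intro c
      exact mem_filter.2 ⟨mem_univ _, fun k => satBy_of_sat hK ((mem_filter.1 hF).2 k) c⟩
    have h4 : (#G : ℝ) ≤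
        Fintype.card (NAEClause K n) * Real.exp (-(147 / 25 / 2 ^ K)) := by
      refine h1.trans (mul_le_mul_of_nonneg_left ?_ hc.le)
      linarith [Real.add_one_le_exp (-(147 / 25 / 2 ^ K) : ℝ)]
    push_cast
    rw [div_le_iff₀ (by positivity)]
    refine h2.trans ((pow_le_pow_left₀ (by positivity) h4 m).trans (le_of_eq ?_))
    rw [mul_pow, ← Real.exp_nat_mul, mul_comm]
    ring_nf
  have h1 : ∀ F : Fin m → NAEClause K n, (if HasSpreadTriple a b F then (1 : ℝ) else 0) ≤
      ∑ σ : Fin 3 → Fin n → Bool with IsSpread a b σ,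
        if ∀ k, (toInst F).Sat (σ k) then (1 : ℝ) else 0 := by
    intro F
    have hnn : ∀ σ ∈ (univ.filter fun σ : Fin 3 → Fin n → Bool => IsSpread a b σ),
        (0 : ℝ) ≤ if ∀ k, (toInst F).Sat (σ k) then (1 : ℝ) else 0 :=
      fun _ _ => by split_ifs <;> simp
    split_ifs with h
    · obtain ⟨σ, h2, h3⟩ := h
      refine le_trans (le_of_eq ?_) (single_le_sum hnn (mem_filter.2 ⟨mem_univ σ, h3⟩))
      rw [if_pos h2]
    · exact sum_nonneg hnn
  refine (expect_le_expect fun F _ => h1 F).trans ?_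
  rw [expect_sum_comm]
  refine (sum_le_sum fun σ hσ => hone σ (mem_filter.1 hσ).2).trans ?_
  rw [sum_const, nsmul_eq_mul]
  exact mul_le_mul_of_nonneg_right (card_isSpread_le a b) (Real.exp_nonneg _)

open Classical in
-- The exponent per variable is at most `(1 + 8/100 - 147/100) ln 2 + 1/8 < -1/10`. The factor `exp
-- 6` absorbs the rounding of the number of clauses.
theorem tendsto_expect_hasSpreadTriple (hK : 0 < K)
    (hKa : 2 * (1 - 1 / 400 : ℝ) ^ K ≤ 1 / 50) {d : ℝ}
    (hd : (2 : ℝ) ^ ((K : ℤ) - 2) * Real.log 2 < d) :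
    Filter.Tendsto (fun n : ℕ => 𝔼 F : Fin ⌊d * n⌋₊ → NAEClause K n,
      if HasSpreadTriple (1 / 400) (1 / 100) F then (1 : ℝ) else 0) Filter.atTop (nhds 0) := by
  have hlog2 := Real.log_two_gt_d9
  have hlog16 : Real.log 16 = 4 * Real.log 2 := by
    rw [show (16 : ℝ) = 2 ^ 4 by norm_num, Real.log_pow]
    norm_num
  have hd' : Real.log 2 / 4 ≤ d / 2 ^ K := by
    rw [zpow_sub₀ (by norm_num), zpow_natCast] at hd
    rw [le_div_iff₀ (by positivity)]
    norm_num at hd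
    linarith
  have hd0 : 0 ≤ d := le_trans (by positivity) hd.le
  have hlim : Filter.Tendsto (fun n : ℕ => Real.exp 6 * Real.exp (-(1 / 10)) ^ n) Filter.atTop
      (nhds 0) := by
    have := (tendsto_pow_atTop_nhds_zero_of_lt_one (Real.exp_nonneg (-(1 / 10)))
      (by rw [← Real.exp_zero]; exact Real.exp_lt_exp.2 (by norm_num))).const_mul (Real.exp 6)
    rwa [mul_zero] at this
  refine squeeze_zero' (Filter.Eventually.of_forall fun n =>
    expect_nonneg fun _ _ => by split_ifs <;> simp) ?_ hlim
  filter_upwards [Filter.eventually_ge_atTop (max K 1)] with n hn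
  have hn1 : 0 < n := lt_of_lt_of_le (by simp) hn
  have := nonempty_clause (K := K) (n := n) ((le_max_left _ _).trans hn)
  refine (expect_hasSpreadTriple_le hK hn1 (by norm_num) hKa).trans ?_
  have h2 : (2 : ℝ) ^ n = Real.exp (n * Real.log 2) := by
    rw [Real.exp_nat_mul, Real.exp_log (by norm_num)]
  rw [h2, ← Real.exp_nat_mul, ← Real.exp_nat_mul, ← Real.exp_add, ← Real.exp_add, ← Real.exp_add]
  refine Real.exp_le_exp.2 ?_
  have hfl : d * n - 1 ≤ (⌊d * n⌋₊ : ℝ) := (Nat.sub_one_lt_floor _).le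
  have hp : (0 : ℝ) < 2 ^ K := by positivity
  have hp1 : (1 : ℝ) ≤ 2 ^ K := one_le_pow₀ (by norm_num)
  have hinv : (1 : ℝ) / 2 ^ K ≤ 1 := (div_le_one hp).2 hp1
  have hn0 : (0 : ℝ) ≤ n := by positivity
  have h3 : Real.log 2 / 4 * n - 1 ≤ (⌊d * n⌋₊ : ℝ) / 2 ^ K := by
    calc Real.log 2 / 4 * n - 1 ≤ d / 2 ^ K * n - 1 / 2 ^ K :=
          sub_le_sub (mul_le_mul_of_nonneg_right hd' hn0) hinv
      _ = (d * n - 1) / 2 ^ K := by ring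
      _ ≤ _ := by gcongr
  have h4 : (147 / 25 / 2 ^ K * (⌊d * n⌋₊ : ℝ) : ℝ) = 147 / 25 * ((⌊d * n⌋₊ : ℝ) / 2 ^ K) := by ring
  rw [h4, hlog16]
  have h5 : (0.6931471803 : ℝ) * n ≤ Real.log 2 * n := mul_le_mul_of_nonneg_right hlog2.le hn0
  push_cast
  nlinarith

end FirstMoment

/-! ### From the coupling and the first moment to the limit -/

section Assembly

open Finset BigOperators

/-- The rule takes rational values only. -/
def Rule.IsRational (τ : Rule) : Prop :=
  ∀ (V C : Type) [Fintype V] [Fintype C] (Φ : Inst V C) (x : V), ∃ q : ℚ, (τ V C Φ x : ℝ) = q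

instance {V C : Type} [Finite V] [Finite C] : Finite (Inst V C) :=
  Finite.of_injective (fun Φ : Inst V C => (Φ.lit, Φ.sign)) fun Φ Ψ h => by
    cases Φ
    cases Ψ
    simpa using h

/-- For fixed finite `V` and `C` there are finitely many instances, hence a common denominator of
all values of the rule. -/
theorem Rule.IsRational.exists_threshold {τ : Rule} (hτ : τ.IsRational) (V C : Type) [Fintype V]
    [Fintype C] : ∃ (N : ℕ) (k : Inst V C → V → ℕ), N ≠ 0 ∧
      ∀ Φ x, k Φ x ≤ N ∧ (τ V C Φ x : ℝ) = k Φ x / N := by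
  classical
  have := Fintype.ofFinite (Inst V C)
  choose q hq using hτ V C
  set N := ∏ p : Inst V C × V, (q p.1 p.2).den with hN
  have hN0 : N ≠ 0 := prod_ne_zero_iff.2 fun p _ => (q p.1 p.2).den_nz
  have hN' : (0 : ℝ) < N := by exact_mod_cast Nat.pos_of_ne_zero hN0
  have hex : ∀ Φ x, ∃ j : ℕ, j ≤ N ∧ (τ V C Φ x : ℝ) = j / N := by
    intro Φ x
    obtain ⟨c, hc⟩ : (q Φ x).den ∣ N := dvd_prod_of_mem (fun p : Inst V C × V => (q p.1 p.2).den)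
      (mem_univ (Φ, x))
    have h0 : 0 ≤ q Φ x := by
      have := (τ V C Φ x).2.1
      rw [hq] at this
      exact_mod_cast this
    have hval : (τ V C Φ x : ℝ) = ((q Φ x).num.toNat * c : ℕ) / N := by
      have hden : ((q Φ x).den : ℝ) ≠ 0 := by exact_mod_cast (q Φ x).den_nz
      have hc0 : (c : ℝ) ≠ 0 := by
        rintro h
        have : c = 0 := by exact_mod_cast h
        exact hN0 (by rw [hc, this, mul_zero])
      have hnum : (((q Φ x).num.toNat : ℕ) : ℝ) = ((q Φ x).num : ℝ) := by
        have := Int.toNat_of_nonneg (Rat.num_nonneg.2 h0)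
        exact_mod_cast this
      rw [hq, hc]
      push_cast
      rw [hnum, mul_div_mul_right _ _ hc0]
      exact_mod_cast (Rat.num_div_den (q Φ x)).symm
    refine ⟨_, ?_, hval⟩
    have h1 := (τ V C Φ x).2.2
    rw [hval, div_le_one hN'] at h1
    exact_mod_cast h1
  choose k hk using hex
  exact ⟨N, k, hN0, hk⟩

variable {K n m : ℕ}

open Classical in
theorem cube_solve_le {τ : Rule} {ρ : ℕ} (hrat : τ.IsRational) (hloc : τ.IsLocal (2 * ρ))
    (hbal : τ.IsBalanced) (hn : 0 < n) {s : ℝ} (hs : 0 < s) (hs' : s ≤ 1 / 400)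
    (F : Fin m → NAEClause K n) (hF : (interCount F ρ : ℝ) ≤ s ^ 2 * n ^ 2)
    (hF' : ¬ HasSpreadTriple (1 / 400) (1 / 100) F) :
    ((decimate τ (List.finRange n) (toInst F) fun _ => false).toOuterMeasure
      {σ | (toInst F).Sat σ}).toReal ^ 3 ≤ 9 * (s / (1 / 400)) ^ 2 := by
  obtain ⟨N, k, hN, hk⟩ := hrat.exists_threshold (Fin n) (Fin m)
  have : NeZero N := ⟨hN⟩
  have hN' : (N : ℝ) ≠ 0 := by exact_mod_cast hN
  set S : Finset (Fin n → Bool) := univ.filter fun σ => (toInst F).Sat σ with hS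
  have hSset : {σ | (toInst F).Sat σ} = (S : Set (Fin n → Bool)) := by
    ext σ
    simp [hS]
  rw [hSset, decimate_toOuterMeasure k hk S (List.nodup_finRange n),
    ENNReal.toReal_ofReal (expect_nonneg fun _ _ => by split_ifs <;> simp)]
  have hkc : ∀ (Φ : Inst (Fin n) (Fin m)) x, k Φ x ≤ N ∧ k Φ.compl x = N - k Φ x := by
    intro Φ x
    refine ⟨(hk Φ x).1, ?_⟩
    have h1 := hbal (Fin n) (Fin m) Φ x
    rw [(hk Φ x).2, (hk Φ.compl x).2] at h1
    field_simp at h1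
    have h2 : (k Φ.compl x : ℝ) + k Φ x = N := by linarith
    have h3 : k Φ.compl x + k Φ x = N := by exact_mod_cast h2
    omega
  -- An undecorated formula is its own complement, so reversing all seeds complements the output.
  have hcompl : (toInst F).compl = toInst F := by
    simp [Inst.compl, toInst]
  refine cube_expect_mem_le hn (fun u => run k u (List.finRange n) (toInst F) fun _ => false)
    (fun j => univ.filter fun i => Influences (toInst F) ρ i j) ?_ Fin.revPerm ?_
    (a := 1 / 400) (b := 1 / 100) (by norm_num) hs (by norm_num) (by linarith) (by norm_num) ?_ S ?_
  · intro j u v huv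
    refine run_eq_of_influences hloc (fun Φ x Ψ y h => ?_) _ _ j u v fun i hi =>
      huv i (mem_filter.2 ⟨mem_univ i, hi⟩)
    have h' : (k Φ x : ℝ) / N = k Ψ y / N := by rw [← (hk Φ x).2, ← (hk Ψ y).2, h]
    rw [div_left_inj' hN'] at h'
    exact_mod_cast h'
  · intro u j
    have h := run_compl k hkc u (List.finRange n) (toInst F) (fun _ => false) (fun _ => false)
      (x := j) (Or.inl (List.mem_finRange j))
    rw [hcompl] at h
    exact h
  · refine le_trans (le_of_eq ?_) hF
    rw [interCount]
    congr 2
    ext jk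
    simp only [mem_filter, mem_univ, true_and, Finset.not_disjoint_iff]
    rfl
  · intro σ hσ hsp
    exact hF' ⟨σ, fun k => (mem_filter.1 (hσ k)).2, hsp⟩

theorem tendsto_successProb {τ : Rule} {ρ : ℕ} (hrat : τ.IsRational) (hloc : τ.IsLocal (2 * ρ))
    (hbal : τ.IsBalanced) (hK : 0 < K) (hKa : 2 * (1 - 1 / 400 : ℝ) ^ K ≤ 1 / 50) {d : ℝ}
    (hd : (2 : ℝ) ^ ((K : ℤ) - 2) * Real.log 2 < d) :
    Filter.Tendsto (fun n : ℕ => successProb τ K d n) Filter.atTop (nhds 0) := by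
  classical
  have hd0 : 0 ≤ d := le_trans (mul_nonneg (by positivity) (Real.log_nonneg (by norm_num))) hd.le
  set p : ∀ n : ℕ, (Fin ⌊d * n⌋₊ → NAEClause K n) → ENNReal := fun n F =>
    (decimate τ (List.finRange n) (toInst F) fun _ => false).toOuterMeasure
      {σ | (toInst F).Sat σ} with hp
  have hp1 : ∀ n F, p n F ≤ 1 := fun n F =>
    (MeasureTheory.measure_mono (Set.subset_univ _)).trans
      ((PMF.toOuterMeasure_apply_eq_one_iff _ _).2 (Set.subset_univ _)).le
  have hptop : ∀ n F, p n F ≠ ⊤ := fun n F => ne_top_of_le_ne_top ENNReal.one_ne_top (hp1 n F)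
  have hreal : ∀ᶠ n : ℕ in Filter.atTop,
      ENNReal.ofReal (𝔼 F, (p n F).toReal) = successProb τ K d n := by
    filter_upwards [Filter.eventually_ge_atTop K] with n hn
    have := nonempty_clause (K := K) (n := n) hn
    have hc : (0 : ℝ) < Fintype.card (Fin ⌊d * n⌋₊ → NAEClause K n) := by
      exact_mod_cast Fintype.card_pos
    rw [Fintype.expect_eq_sum_div_card, ENNReal.ofReal_div_of_pos hc, ENNReal.ofReal_natCast,
      ENNReal.ofReal_sum_of_nonneg fun _ _ => ENNReal.toReal_nonneg, successProb]
    congr 1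
    exact sum_congr rfl fun F _ => ENNReal.ofReal_toReal (hptop n F)
  refine Filter.Tendsto.congr' hreal ?_
  rw [← ENNReal.ofReal_zero]
  refine ENNReal.tendsto_ofReal ?_
  rw [Metric.tendsto_atTop']
  intro ε hε
  set η := min (ε / 4) 1 with hη
  have hη0 : 0 < η := lt_min (by positivity) one_pos
  have hη1 : η ≤ 1 := min_le_right _ _
  have hη2 : 3 * η < ε := by linarith [min_le_left (ε / 4) 1]
  -- With this choice `9 (400 s)^2 = η^4 ≤ η^3`, so `cube_solve_le` bounds the success probability
  -- by `η`.
  set s := η ^ 2 / 1200 with hs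
  have hs0 : 0 < s := by positivity
  have hs1 : s ≤ 1 / 400 := by
    have : η ^ 2 ≤ 1 := pow_le_one₀ hη0.le hη1
    rw [hs]
    linarith
  have hmain := ((tendsto_expect_hasSpreadTriple hK hKa hd).eventually_le_const hη0).and
    ((eventually_expect_interCount_le K ρ hd0 (ε := η * s ^ 2) (by positivity)).and
      (Filter.eventually_ge_atTop (max K 1)))
  obtain ⟨n₀, hn₀⟩ := Filter.eventually_atTop.1 hmain
  refine ⟨n₀, fun n hn => ?_⟩
  obtain ⟨h1, h2, h3⟩ := hn₀ n hn.le
  have hn1 : 0 < n := lt_of_lt_of_le (by simp) h3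
  have hne := nonempty_clause (K := K) (n := n) ((le_max_left _ _).trans h3)
  have h2 := h2 hne
  have hnR : (0 : ℝ) < n := by exact_mod_cast hn1
  -- The last term is Markov's inequality in pointwise form: it is at least 1 on formulas with too
  -- many interacting pairs.
  have hpt : ∀ F : Fin ⌊d * n⌋₊ → NAEClause K n, (p n F).toReal ≤
      η + (if HasSpreadTriple (1 / 400) (1 / 100) F then (1 : ℝ) else 0) +
        (s ^ 2 * n ^ 2)⁻¹ * interCount F ρ := by
    intro F
    have hpF : (p n F).toReal ≤ 1 := by
      simpa using ENNReal.toReal_mono ENNReal.one_ne_top (hp1 n F)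
    have hi0 : 0 ≤ (s ^ 2 * n ^ 2)⁻¹ * (interCount F ρ : ℝ) := by positivity
    split_ifs with hT
    · linarith
    · by_cases hQ : (interCount F ρ : ℝ) ≤ s ^ 2 * n ^ 2
      · have h4 := cube_solve_le hrat hloc hbal hn1 hs0 hs1 F hQ hT
        have h5 : 9 * (s / (1 / 400)) ^ 2 ≤ η ^ 3 := by
          have : 9 * (s / (1 / 400)) ^ 2 = η ^ 3 * η := by rw [hs]; ring
          rw [this]
          exact mul_le_of_le_one_right (by positivity) hη1
        have h6 : (p n F).toReal ≤ η :=
          le_of_pow_le_pow_left₀ (by norm_num) hη0.le (h4.trans h5)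
        linarith
      · push Not at hQ
        have : 1 ≤ (s ^ 2 * n ^ 2)⁻¹ * (interCount F ρ : ℝ) := by
          rw [← div_eq_inv_mul, le_div_iff₀ (by positivity)]
          linarith
        linarith
  have hE : (𝔼 F, (p n F).toReal) ≤ 3 * η := by
    refine (expect_le_expect fun F _ => hpt F).trans ?_
    rw [expect_add_distrib, expect_add_distrib, expect_const univ_nonempty, ← mul_expect]
    have : (s ^ 2 * (n : ℝ) ^ 2)⁻¹ *
        (𝔼 F : Fin ⌊d * n⌋₊ → NAEClause K n, (interCount F ρ : ℝ)) ≤ η := by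
      rw [← div_eq_inv_mul, div_le_iff₀ (by positivity)]
      linarith
    linarith
  rw [Real.dist_eq, sub_zero, abs_of_nonneg (expect_nonneg fun _ _ => ENNReal.toReal_nonneg)]
  linarith

end Assembly

end NAESat

theorem mainTheorem5 :
    (∀ r : ℕ, 0 < r →
      ((NAESat.bpRule r).IsLocal (NAESat.evenDepth r) ∧ (NAESat.bpRule r).IsBalanced) ∧
      ((NAESat.marginalRule (NAESat.evenDepth r)).IsLocal (NAESat.evenDepth r) ∧
        (NAESat.marginalRule (NAESat.evenDepth r)).IsBalanced)) ∧
    ∃ K₀ : ℕ, ∀ K : ℕ, K₀ ≤ K → ∀ d : ℝ, (2 : ℝ) ^ ((K : ℤ) - 2) * Real.log 2 < d →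
      ∀ r : ℕ, 0 < r →
        Filter.Tendsto (fun n : ℕ => NAESat.successProb (NAESat.bpRule r) K d n)
          Filter.atTop (nhds 0) ∧
        Filter.Tendsto
          (fun n : ℕ => NAESat.successProb (NAESat.marginalRule (NAESat.evenDepth r)) K d n)
          Filter.atTop (nhds 0) := by
  refine ⟨fun r hr => ⟨⟨NAESat.bpRule_isLocal hr, NAESat.bpRule_isBalanced r⟩,
    NAESat.marginalRule_isLocal _, NAESat.marginalRule_isBalanced _⟩, ?_⟩
  -- Largeness of `K` is needed only to make joint violations rare, so `K₀` depends on neither `d`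
  -- nor `r`.
  have hlim := (tendsto_pow_atTop_nhds_zero_of_lt_one (r := (1 - 1 / 400 : ℝ)) (by norm_num)
    (by norm_num)).const_mul 2
  rw [mul_zero] at hlim
  obtain ⟨K₀, hK₀⟩ := Filter.eventually_atTop.1
    ((hlim.eventually_le_const (by norm_num : (0 : ℝ) < 1 / 50)).and
      (Filter.eventually_gt_atTop 0))
  refine ⟨K₀, fun K hK d hd r hr => ?_⟩
  obtain ⟨hKa, hK0⟩ := hK₀ K hK
  exact ⟨NAESat.tendsto_successProb (fun _ _ _ _ _ _ => NAESat.exists_rat_eq_fraction _ _)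
      (NAESat.bpRule_isLocal hr) (NAESat.bpRule_isBalanced r) hK0 hKa hd,
    NAESat.tendsto_successProb (fun _ _ _ _ _ _ => NAESat.exists_rat_eq_fraction _ _)
      (NAESat.marginalRule_isLocal _) (NAESat.marginalRule_isBalanced _) hK0 hKa hd⟩
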